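/- Let $\Omega\subset\mathbb R^d$, $s,k\ge 0$, and let $\Pi^d_s$ be the space of $d$-variate real polynomials of total degree less than $s$ ($\Pi^d_0=\{0\}$). Let $K:\Omega\times\Omega\to\mathbb R$ be a symmetric conditionally positive definite kernel of order $s$, that is, $\sum_{i,j}c_ic_jK(y_i,y_j)>0$ for all finitely many distinct points $y_i\in\Omega$ and all coefficients $c_i$, not all zero, with $\sum_i c_ip(y_i)=0$ for all $p\in\Pi^d_s$. Let $\mathcal F_K$ be its native space: the completion, realized as a space of functions on $\Omega$ by pointwise limits, of the space of functions $f=\sum_i c_iK(\cdot,y_i)+p$ with $p\in\Pi^d_s$ and $\sum_i c_iq(y_i)=0$ for all $q\in\Pi^d_s$, equipped with the semi-norm $\|f\|_K=\big(\sum_{i,j}c_ic_jK(y_i,y_j)\big)^{1/2}$. Let $D=\sum_{|\alpha|\le k}a_\alpha\partial^\alpha$ be a linear differential operator of order $k$ with variable coefficients, let $z,x_1,\dots,x_N\in\Omega$ and $w\in\mathbb R^N$, and consider the error functional $$\varepsilon_w f:=Df(z)-\sum_{j=1}^N w_jf(x_j).$$ Assume that $\varepsilon_wp=0$ for all $p\in\Pi^d_s$,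 and that $\partial^{\alpha,\beta}K(z,z)$ exists for all $|\alpha|,|\beta|\le k$ in the following sense: if $k>0$, then $z$ is an interior point of $\Omega$, all mixed partial derivatives of $K$ with at most $k$ differentiations in the first and at most $k$ differentiations in the second argument, taken in any order, exist in a neighbourhood of $(z,z)$, and those of positive order are continuous at $(z,z)$ (no condition if $k=0$). Then all partial derivatives of order at most $k$ at $z$ of every $f\in\mathcal F_K$, of every $K(y,\cdot)$, $y\in\Omega$, and of $\varepsilon_w''K$ exist, the functional $\varepsilon_w$ is continuous on $\mathcal F_K$, and $$\|\varepsilon_w\|_K^2=\varepsilon_w'\varepsilon_w''K,$$ where $\|\varepsilon_w\|_K$ is the norm of $\varepsilon_w$ as a bounded linear functional on $\mathcal F_K$, and $\varepsilon_w''$ and $\varepsilon_w'$ denote the application of $\varepsilon_w$ to the second argument of $K$ and then to the first. The points $x_1,\dots,x_N$ need not form a determining set for $\Pi^d_s$. -/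

import Mathlib

open Filter Topology

noncomputable section

/-- The Euclidean space `ℝᵈ`. -/
abbrev Eucl (d : ℕ) : Type := EuclideanSpace ℝ (Fin d)

/-! ### Functions on a subset and iterated partial derivatives -/

/-- Extension by zero of a function given on `Ω ⊆ ℝᵈ`. Only used to differentiate at interior points
of `Ω`, where the values outside of `Ω` play no role. -/
def zeroExt {d : ℕ} {Ω : Set (Eucl d)} (f : Ω → ℝ) : Eucl d → ℝ :=
  Function.extend Subtype.val f 0

/-- The iterated directional derivative `∂_{v₁} (∂_{v₂} (⋯ ∂_{vₙ} f))` for the list `[v₁, …, vₙ]`. -/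
def iterDeriv {V : Type} [NormedAddCommGroup V] [NormedSpace ℝ V] (f : V → ℝ) : List V → V → ℝ
  | [] => f
  | v :: l => fun x => lineDeriv ℝ (iterDeriv f l) x v

/-- The iterated derivative `∂_{v₁} (∂_{v₂} (⋯ ∂_{vₙ} f))` exists at `x`: the inner one exists in a
neighbourhood of `x` and is differentiable at `x` in the direction of `v₁`. -/
def IterDerivExistsAt {V : Type} [NormedAddCommGroup V] [NormedSpace ℝ V] (f : V → ℝ) :
    List V → V → Prop
  | [], _ => True
  | v :: l, x => (∀ᶠ y in 𝓝 x, IterDerivExistsAt f l y) ∧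
      LineDifferentiableAt ℝ (iterDeriv f l) x v

/-- The `i`-th coordinate direction of `ℝᵈ`. -/
def coordDir {d : ℕ} (i : Fin d) : Eucl d := EuclideanSpace.single i 1

/-- The coordinate directions of `ℝᵈ × ℝᵈ`: `inl i` is the `i`-th direction in the first argument,
`inr i` the `i`-th direction in the second argument. -/
def coordDir₂ {d : ℕ} : Fin d ⊕ Fin d → Eucl d × Eucl d
  | Sum.inl i => (coordDir i, 0)
  | Sum.inr i => (0, coordDir i)

/-- The list `1, …, 1, 2, …, 2, …, d, …, d` in which `i` occurs `α i` times. -/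
def multiIndexList {d : ℕ} (α : Fin d → ℕ) : List (Fin d) :=
  (List.finRange d).flatMap fun i => List.replicate (α i) i

/-- The partial derivative `∂^α f = ∂₁^{α₁} ⋯ ∂_d^{α_d} f`. -/
def multiDeriv {d : ℕ} (α : Fin d → ℕ) (f : Eucl d → ℝ) : Eucl d → ℝ :=
  iterDeriv f ((multiIndexList α).map coordDir)

/-- The differential operator `D f = ∑_{|α| ≤ k} a_α ∂^α f` with variable coefficients `a_α`. -/
def diffOp {d : ℕ} (k : ℕ) (a : (Fin d → ℕ) → Eucl d → ℝ) (f : Eucl d → ℝ) (z : Eucl d) : ℝ :=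
  ∑ m ∈ Finset.range (k + 1), ∑ α ∈ Finset.piAntidiag Finset.univ m, a α z * multiDeriv α f z

/-- All partial derivatives of order at most `k` (in every order of differentiation) of `f : Ω → ℝ`
exist at the point `z`. -/
def HasPartialsAt {d : ℕ} {Ω : Set (Eucl d)} (k : ℕ) (f : Ω → ℝ) (z : Ω) : Prop :=
  ∀ l : List (Fin d), l.length ≤ k → IterDerivExistsAt (zeroExt f) (l.map coordDir) z.1

/-- A function of two variables in `Ω`, extended by zero to `ℝᵈ × ℝᵈ`. -/
def zeroExt₂ {d : ℕ} {Ω : Set (Eucl d)} (K : Ω → Ω → ℝ) (p : Eucl d × Eucl d) : ℝ :=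
  zeroExt (fun x => zeroExt (K x) p.2) p.1

/-- Existence of the partial derivatives `∂^{α,β} K`, `|α|, |β| ≤ k`, at `(z, z)`: each mixed partial
derivative with at most `k` differentiations in the first and at most `k` in the second argument,
taken in any order, exists in a neighbourhood of `(z, z)` and, unless it is `K` itself, is
continuous at `(z, z)`. If `k > 0`, then `z` has to be an interior point of `Ω`; nothing is demanded
for `k = 0`. -/
def KernelPartialsExistAt {d : ℕ} {Ω : Set (Eucl d)} (k : ℕ) (K : Ω → Ω → ℝ) (z : Ω) : Prop :=
  (0 < k → Ω ∈ 𝓝 z.1) ∧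
  ∀ l : List (Fin d ⊕ Fin d), l.countP Sum.isLeft ≤ k → l.countP Sum.isRight ≤ k →
    (∀ᶠ p in 𝓝 (z.1, z.1), IterDerivExistsAt (zeroExt₂ K) (l.map coordDir₂) p) ∧
    (l ≠ [] → ContinuousAt (iterDeriv (zeroExt₂ K) (l.map coordDir₂)) (z.1, z.1))

/-! ### Conditionally positive definite kernels -/

/-- The space `Π^d_s` of `d`-variate polynomials of total degree less than `s`
(in particular `Π^d_0 = {0}`). -/
def polySpace (d s : ℕ) : Submodule ℝ (MvPolynomial (Fin d) ℝ) :=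
  MvPolynomial.restrictSupport ℝ {n | n.degree < s}

/-- A polynomial as a function on `Ω`. -/
def polyFun {d : ℕ} (Ω : Set (Eucl d)) (p : MvPolynomial (Fin d) ℝ) (x : Ω) : ℝ :=
  MvPolynomial.eval (fun i => x.1 i) p

/-- The functional `f ↦ ∑ⱼ cⱼ f(xⱼ)` with finitely many distinct points `xⱼ ∈ Ω`
and coefficients `cⱼ`. -/
def pointFunctional {X : Type} (c : X →₀ ℝ) (f : X → ℝ) : ℝ := Finsupp.linearCombination ℝ f c

/-- The finitely supported functionals on `Ω` that annihilate `Π^d_s`. -/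
def annihilator {d : ℕ} (Ω : Set (Eucl d)) (s : ℕ) : Submodule ℝ (Ω →₀ ℝ) where
  carrier := {c | ∀ p ∈ polySpace d s, pointFunctional c (polyFun Ω p) = 0}
  zero_mem' := fun p _ => by simp [pointFunctional]
  add_mem' := fun {a b} ha hb p hp => by
    have h1 := ha p hp
    have h2 := hb p hp
    simp only [pointFunctional] at h1 h2 ⊢
    rw [map_add, h1, h2, add_zero]
  smul_mem' := fun r a ha p hp => by
    have h1 := ha p hp
    simp only [pointFunctional] at h1 ⊢
    rw [map_smul, h1, smul_zero]

/-- The bilinear form `∑ᵢⱼ cᵢ bⱼ K(xᵢ, yⱼ)`. -/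
def kernelForm {X : Type} (K : X → X → ℝ) (c b : X →₀ ℝ) : ℝ :=
  pointFunctional c fun x => pointFunctional b fun y => K x y

/-- A symmetric conditionally positive definite kernel of order `s` on `Ω ⊆ ℝᵈ`
(strictly positive definite if `s = 0`). -/
structure CPDKernel {d : ℕ} (Ω : Set (Eucl d)) (s : ℕ) where
  /-- the kernel -/
  toFun : Ω → Ω → ℝ
  symm : ∀ x y, toFun x y = toFun y x
  pos : ∀ c ∈ annihilator Ω s, c ≠ 0 → 0 < kernelForm toFun c c

instance {d : ℕ} {Ω : Set (Eucl d)} {s : ℕ} :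
    CoeFun (CPDKernel Ω s) (fun _ => Ω → Ω → ℝ) := ⟨CPDKernel.toFun⟩

lemma pointFunctional_add_left {X : Type} (c b : X →₀ ℝ) (f : X → ℝ) :
    pointFunctional (c + b) f = pointFunctional c f + pointFunctional b f := by
  simp [pointFunctional]

lemma pointFunctional_smul_left {X : Type} (r : ℝ) (c : X →₀ ℝ) (f : X → ℝ) :
    pointFunctional (r • c) f = r * pointFunctional c f := by
  simp [pointFunctional]

lemma pointFunctional_add_right {X : Type} (c : X →₀ ℝ) (f g : X → ℝ) :
    pointFunctional c (fun x => f x + g x) = pointFunctional c f + pointFunctional c g := by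
  simp [pointFunctional, Finsupp.linearCombination_apply, Finsupp.sum, mul_add,
    Finset.sum_add_distrib]

lemma pointFunctional_smul_right {X : Type} (r : ℝ) (c : X →₀ ℝ) (f : X → ℝ) :
    pointFunctional c (fun x => r * f x) = r * pointFunctional c f := by
  simp only [pointFunctional, Finsupp.linearCombination_apply, Finsupp.sum, smul_eq_mul,
    Finset.mul_sum]
  exact Finset.sum_congr rfl fun _ _ => by ring

lemma kernelForm_comm {X : Type} {K : X → X → ℝ} (hK : ∀ x y, K x y = K y x) (c b : X →₀ ℝ) :
    kernelForm K c b = kernelForm K b c := by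
  simp only [kernelForm, pointFunctional, Finsupp.linearCombination_apply, Finsupp.sum,
    smul_eq_mul, Finset.mul_sum]
  rw [Finset.sum_comm]
  exact Finset.sum_congr rfl fun _ _ => Finset.sum_congr rfl fun _ _ => by rw [hK]; ring

/-! ### The native space -/

/-- The coefficients `a` of the functions `∑ᵢ aᵢ K(·, xᵢ)` with `∑ᵢ aᵢ p(xᵢ) = 0` for all
`p ∈ Π^d_s`, which carry the inner product `∑ᵢⱼ aᵢ bⱼ K(xᵢ, yⱼ)`. -/
def PreNative {d : ℕ} {Ω : Set (Eucl d)} {s : ℕ} (_K : CPDKernel Ω s) : Type := annihilator Ω s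

section PreNative

variable {d : ℕ} {Ω : Set (Eucl d)} {s : ℕ} (K : CPDKernel Ω s)

instance : AddCommGroup (PreNative K) := inferInstanceAs (AddCommGroup (annihilator Ω s))

instance : Module ℝ (PreNative K) := inferInstanceAs (Module ℝ (annihilator Ω s))

/-- The coefficient vector, as a finitely supported function on `Ω`. -/
def PreNative.coeff {K : CPDKernel Ω s} (c : PreNative K) : Ω →₀ ℝ := Subtype.val c

/-- The inner product `∑ᵢⱼ aᵢ bⱼ K(xᵢ, yⱼ)`. -/
@[reducible] def preNativeCore : InnerProductSpace.Core ℝ (PreNative K) where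
  inner a b := kernelForm K a.coeff b.coeff
  conj_inner_symm a b := kernelForm_comm K.symm _ _
  re_inner_nonneg a := by
    by_cases h : a.coeff = 0
    · simp [h, kernelForm, pointFunctional]
    · exact (K.pos a.coeff a.2 h).le
  add_left a b c := pointFunctional_add_left _ _ _
  smul_left a b r := pointFunctional_smul_left _ _ _
  definite a h := by
    by_contra h0
    have h1 : a.coeff ≠ 0 := fun h2 => h0 (Subtype.ext h2)
    exact (K.pos a.coeff a.2 h1).ne' h

instance : NormedAddCommGroup (PreNative K) := (preNativeCore K).toNormedAddCommGroup

instance : InnerProductSpace ℝ (PreNative K) :=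
  InnerProductSpace.ofCore (preNativeCore K).toCore

/-- The Hilbert space completion of `PreNative K`. -/
abbrev NativeCompletion : Type := UniformSpace.Completion (PreNative K)

/-- The function `∑ⱼ aⱼ K(·, xⱼ)` on `Ω`. -/
def PreNative.toFun {K : CPDKernel Ω s} (a : PreNative K) (x : Ω) : ℝ :=
  pointFunctional a.coeff fun y => K x y

/-- `f : Ω → ℝ` is the pointwise limit of functions `fₙ = ∑ⱼ aₙⱼ K(·, xₙⱼ) + pₙ`, `pₙ ∈ Π^d_s`, whose
coefficient vectors form a Cauchy sequence with limit `h` in the completion. -/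
def IsNativeLimit (f : Ω → ℝ) (h : NativeCompletion K) : Prop :=
  ∃ (a : ℕ → PreNative K) (p : ℕ → MvPolynomial (Fin d) ℝ), (∀ n, p n ∈ polySpace d s) ∧
    Tendsto (fun n => (a n : NativeCompletion K)) atTop (𝓝 h) ∧
    ∀ x, Tendsto (fun n => (a n).toFun x + polyFun Ω (p n) x) atTop (𝓝 (f x))

variable {K}

lemma IsNativeLimit.pointFunctional_eq {f : Ω → ℝ} {h : NativeCompletion K}
    (H : IsNativeLimit K f h) (c : PreNative K) :
    pointFunctional c.coeff f = inner ℝ (c : NativeCompletion K) h := by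
  obtain ⟨a, p, hp, ha, hf⟩ := H
  have h1 : Tendsto (fun n => pointFunctional c.coeff
      (fun x => (a n).toFun x + polyFun Ω (p n) x)) atTop (𝓝 (pointFunctional c.coeff f)) := by
    simp only [pointFunctional, Finsupp.linearCombination_apply, Finsupp.sum, smul_eq_mul]
    exact tendsto_finsetSum _ fun x _ => (hf x).const_mul _
  have h2 : ∀ n, pointFunctional c.coeff (fun x => (a n).toFun x + polyFun Ω (p n) x)
      = inner ℝ (c : NativeCompletion K) (a n : NativeCompletion K) := by
    intro n
    have h3 : pointFunctional c.coeff (polyFun Ω (p n)) = 0 := c.2 (p n) (hp n)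
    rw [pointFunctional_add_right, h3, add_zero, UniformSpace.Completion.inner_coe]
    rfl
  simp only [h2] at h1
  exact tendsto_nhds_unique h1 (tendsto_const_nhds.inner ha)

lemma IsNativeLimit.unique {f : Ω → ℝ} {h h' : NativeCompletion K}
    (H : IsNativeLimit K f h) (H' : IsNativeLimit K f h') : h = h' := by
  have key : ∀ g : NativeCompletion K, inner ℝ g h = inner ℝ g h' := by
    intro g
    induction g using UniformSpace.Completion.induction_on with
    | hp => exact isClosed_eq (continuous_id.inner continuous_const)
              (continuous_id.inner continuous_const)
    | ih c => rw [← H.pointFunctional_eq, ← H'.pointFunctional_eq]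
  exact ext_inner_left ℝ key

lemma IsNativeLimit.zero : IsNativeLimit K 0 0 :=
  ⟨fun _ => 0, fun _ => 0, fun _ => Submodule.zero_mem _,
    by simp [UniformSpace.Completion.coe_zero], fun x => by
      have : (0 : PreNative K).toFun x = 0 := by
        show pointFunctional (0 : Ω →₀ ℝ) _ = 0
        simp [pointFunctional]
      simp [this, polyFun]⟩

lemma IsNativeLimit.add {f g : Ω → ℝ} {h h' : NativeCompletion K}
    (H : IsNativeLimit K f h) (H' : IsNativeLimit K g h') : IsNativeLimit K (f + g) (h + h') := by
  obtain ⟨a, p, hp, ha, hf⟩ := H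
  obtain ⟨b, q, hq, hb, hg⟩ := H'
  refine ⟨fun n => a n + b n, fun n => p n + q n, fun n => Submodule.add_mem _ (hp n) (hq n), ?_, ?_⟩
  · simpa only [UniformSpace.Completion.coe_add] using ha.add hb
  · intro x
    refine ((hf x).add (hg x)).congr fun n => ?_
    have : (a n + b n).toFun x = (a n).toFun x + (b n).toFun x := pointFunctional_add_left _ _ _
    rw [this]
    simp only [polyFun, map_add]
    ring

lemma IsNativeLimit.smul {f : Ω → ℝ} {h : NativeCompletion K} (r : ℝ)
    (H : IsNativeLimit K f h) : IsNativeLimit K (r • f) (r • h) := by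
  obtain ⟨a, p, hp, ha, hf⟩ := H
  refine ⟨fun n => r • a n, fun n => r • p n, fun n => Submodule.smul_mem _ _ (hp n), ?_, ?_⟩
  · simpa only [UniformSpace.Completion.coe_smul] using ha.const_smul r
  · intro x
    refine ((hf x).const_mul r).congr fun n => ?_
    have : (r • a n).toFun x = r * (a n).toFun x := pointFunctional_smul_left _ _ _
    rw [this]
    simp only [polyFun, MvPolynomial.smul_eval]
    ring

variable (K)

/-- The native space of `K`, as a space of functions on `Ω`: the completion of the space of functions
`∑ⱼ aⱼ K(·, xⱼ) + p` with `p ∈ Π^d_s` and coefficients annihilating `Π^d_s`. -/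
def nativeSubmodule : Submodule ℝ (Ω → ℝ) where
  carrier := {f | ∃ h, IsNativeLimit K f h}
  zero_mem' := ⟨0, IsNativeLimit.zero⟩
  add_mem' := fun ⟨_, h1⟩ ⟨_, h2⟩ => ⟨_, h1.add h2⟩
  smul_mem' := fun r _ ⟨_, h1⟩ => ⟨_, h1.smul r⟩

/-- The native space of `K`, to be equipped with its semi-inner product. -/
def NativeSpace : Type := nativeSubmodule K

instance : AddCommGroup (NativeSpace K) := inferInstanceAs (AddCommGroup (nativeSubmodule K))

instance : Module ℝ (NativeSpace K) := inferInstanceAs (Module ℝ (nativeSubmodule K))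

instance : CoeFun (NativeSpace K) (fun _ => Ω → ℝ) := ⟨fun f => Subtype.val f⟩

/-- The class in the completion of a function in the native space. -/
def nativeClass : NativeSpace K →ₗ[ℝ] NativeCompletion K where
  toFun f := f.2.choose
  map_add' f g := (f + g).2.choose_spec.unique (f.2.choose_spec.add g.2.choose_spec)
  map_smul' r f := (r • f).2.choose_spec.unique (f.2.choose_spec.smul r)

/-- The semi-inner product of the native space: that of the classes in the completion. -/
@[reducible] def nativeCore : PreInnerProductSpace.Core ℝ (NativeSpace K) where
  inner f g := inner ℝ (nativeClass K f) (nativeClass K g)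
  conj_inner_symm f g := inner_conj_symm _ _
  re_inner_nonneg f := inner_self_nonneg
  add_left f g h := by rw [map_add, inner_add_left]
  smul_left f g r := by rw [map_smul, inner_smul_left]

instance : SeminormedAddCommGroup (NativeSpace K) :=
  @InnerProductSpace.Core.toSeminormedAddCommGroup ℝ _ _ _ _ (nativeCore K)

instance : InnerProductSpace ℝ (NativeSpace K) := InnerProductSpace.ofCore (nativeCore K)

end PreNative

/-- The error functional `f ↦ D f(z) - ∑ⱼ wⱼ f(xⱼ)` of a numerical differentiation formula,
for `D = ∑_{|α| ≤ k} a_α ∂^α`. -/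
def errorFunctional {d : ℕ} {Ω : Set (Eucl d)} (k : ℕ) (a : (Fin d → ℕ) → Eucl d → ℝ) (z : Ω)
    {N : ℕ} (x : Fin N → Ω) (w : Fin N → ℝ) (f : Ω → ℝ) : ℝ :=
  diffOp k a (zeroExt f) z.1 - ∑ j, w j * f (x j)

end

/-! Choose finitely many points `t ∈ T` and polynomials `P t ∈ Π^d_s` reproducing every `q ∈ Π^d_s`
on `Ω` from its values on `T`. Then `δ_x - ∑ t, P t x • δ_t` annihilates `Π^d_s`, so it is an
element `E x` of the Hilbert space completion (`interpError`), and a native function with class `h`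
is `f x = ⟪E x, h⟫` plus its interpolating polynomial (`IsNativeLimit.eq_inner_add`). The points `x
j` play no role in choosing `T`, so they need not determine `Π^d_s`.

Differentiating native functions thus reduces to differentiating the one map `E`. Its Gram kernel
`⟪E x, E y⟫` is `K x y` plus a finite sum of products `a x * b y`. Inner products of difference
quotients of `E` are mixed second difference quotients of this kernel, which converge to a mixed
derivative (`tendsto_mixed_slope`). Hence the quotients are Cauchy
(`exists_tendsto_of_tendsto_inner`), and induction on the order gives all derivatives of `E` up to
order `k` at `z` (`hasIterPartials_of_gram`).

Since the error functional kills `Π^d_s`, it acts on `f` as `⟪v, h⟫` with `v = D E(z) - ∑ j, w j • E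
(x j)`. Every `h` is the class of a native function (`isNativeLimit_inner_interpError`), so the norm
is `‖v‖`. Up to terms in `Π^d_s`, applying the functional to one argument of `K` gives `⟪E y, v⟫`
(`kernel_eq_inner_add`), and applying it again gives `⟪v, v⟫`. -/

noncomputable section

/-! ### Iterated directional derivatives of vector-valued functions -/

section IteratedPartials

variable {ι V W W' : Type*} [NormedAddCommGroup V] [NormedSpace ℝ V]
  [NormedAddCommGroup W] [NormedSpace ℝ W] [NormedAddCommGroup W'] [NormedSpace ℝ W']

/-- The iterated directional derivative `∂_{e i₁} (∂_{e i₂} (⋯ ∂_{e iₙ} f))` of a vector-valued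
function, for the list `[i₁, …, iₙ]`. -/
def iterPartial (e : ι → V) (f : V → W) : List ι → V → W
  | [] => f
  | i :: l => fun x => lineDeriv ℝ (iterPartial e f l) x (e i)

/-- All iterated directional derivatives of `f` of order less than `k` exist on `U`, and those of
order `k` exist at `z`. -/
def HasIterPartials (e : ι → V) (U : Set V) (z : V) (k : ℕ) (f : V → W) : Prop :=
  ∀ (l : List ι) (i : ι), ∀ x ∈ U, l.length < k → (x = z ∨ l.length + 1 < k) →
    LineDifferentiableAt ℝ (iterPartial e f l) x (e i)

variable {e : ι → V} {U : Set V} {z : V} {k : ℕ} {f g : V → W}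

lemma iterDeriv_map_eq_iterPartial {V : Type} [NormedAddCommGroup V] [NormedSpace ℝ V]
    (e : ι → V) (f : V → ℝ) (l : List ι) : iterDeriv f (l.map e) = iterPartial e f l := by
  induction l with
  | nil => rfl
  | cons i l ih => simp only [List.map_cons, iterDeriv, iterPartial, ih]

lemma eventually_mem_line (hU : IsOpen U) {x : V} (hx : x ∈ U) (v : V) :
    ∀ᶠ t : ℝ in 𝓝 0, x + t • v ∈ U := by
  have h : Continuous fun t : ℝ => x + t • v := by fun_prop
  exact h.continuousAt.eventually_mem (by simpa using hU.mem_nhds hx)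

/-- A family `g` that satisfies the recursion for iterated derivatives must be the family of
derivatives, by induction on the list: equality on the open set `U` passes to line derivatives. The
alternative `l = []` matters for `k = 0`, where `l.length < k` fails even for the function itself.
-/
lemma HasIterPartials.of_succ_eq (hU : 0 < k → IsOpen U) {g : List ι → V → W}
    (h0 : ∀ x ∈ U, f x = g [] x)
    (hg : ∀ (l : List ι) (i : ι), ∀ x ∈ U, l.length < k → (x = z ∨ l.length + 1 < k) →
      HasLineDerivAt ℝ (g l) (g (i :: l) x) x (e i)) :
    HasIterPartials e U z k f ∧
      ∀ l : List ι, ∀ x ∈ U, l.length ≤ k → (x = z ∨ l.length < k ∨ l = []) →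
        iterPartial e f l x = g l x := by
  have key : ∀ l : List ι, ∀ x ∈ U, l.length ≤ k → (x = z ∨ l.length < k ∨ l = []) →
      iterPartial e f l x = g l x := by
    intro l
    induction l with
    | nil => exact fun x hx _ _ => h0 x hx
    | cons i l ih =>
      intro x hx hl hz
      simp only [List.length_cons] at hl hz
      have hev : iterPartial e f l =ᶠ[𝓝 x] g l := by
        filter_upwards [(hU (by omega)).mem_nhds hx] with y hy
        exact ih y hy (by omega) (by omega)
      have := hg l i x hx (by omega) (by simpa using hz)
      exact (this.congr_of_eventuallyEq hev).lineDeriv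
  refine ⟨fun l i x hx hl hz => ?_, key⟩
  have hev : iterPartial e f l =ᶠ[𝓝 x] g l := by
    filter_upwards [(hU (by omega)).mem_nhds hx] with y hy
    exact key l y hy (by omega) (by omega)
  exact ((hg l i x hx hl hz).congr_of_eventuallyEq hev).lineDifferentiableAt

lemma HasIterPartials.hasLineDerivAt (hf : HasIterPartials e U z k f) (l : List ι) (i : ι) {x : V}
    (hx : x ∈ U) (hl : l.length < k) (hz : x = z ∨ l.length + 1 < k) :
    HasLineDerivAt ℝ (iterPartial e f l) (iterPartial e f (i :: l) x) x (e i) :=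
  (hf l i x hx hl hz).hasLineDerivAt

lemma HasIterPartials.congr (hU : 0 < k → IsOpen U) (hg : HasIterPartials e U z k g)
    (hfg : ∀ x ∈ U, f x = g x) :
    HasIterPartials e U z k f ∧
      ∀ l : List ι, ∀ x ∈ U, l.length ≤ k → (x = z ∨ l.length < k ∨ l = []) →
        iterPartial e f l x = iterPartial e g l x :=
  HasIterPartials.of_succ_eq hU hfg fun l i _ hx hl hz => hg.hasLineDerivAt l i hx hl hz

lemma HasIterPartials.clm_comp (hU : 0 < k → IsOpen U) (hf : HasIterPartials e U z k f)
    (L : W →L[ℝ] W') :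
    HasIterPartials e U z k (fun x => L (f x)) ∧
      ∀ l : List ι, ∀ x ∈ U, l.length ≤ k → (x = z ∨ l.length < k ∨ l = []) →
        iterPartial e (fun x => L (f x)) l x = L (iterPartial e f l x) :=
  HasIterPartials.of_succ_eq (g := fun l x => L (iterPartial e f l x)) hU (fun _ _ => rfl)
    fun l i _ hx hl hz => L.hasFDerivAt.comp_hasDerivAt (0 : ℝ) (hf.hasLineDerivAt l i hx hl hz)

lemma HasIterPartials.add (hU : 0 < k → IsOpen U) (hf : HasIterPartials e U z k f)
    (hg : HasIterPartials e U z k g) :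
    HasIterPartials e U z k (fun x => f x + g x) ∧
      ∀ l : List ι, ∀ x ∈ U, l.length ≤ k → (x = z ∨ l.length < k ∨ l = []) →
        iterPartial e (fun x => f x + g x) l x = iterPartial e f l x + iterPartial e g l x :=
  HasIterPartials.of_succ_eq (g := fun l x => iterPartial e f l x + iterPartial e g l x) hU
    (fun _ _ => rfl) fun l i _ hx hl hz =>
      HasDerivAt.fun_add (hf.hasLineDerivAt l i hx hl hz) (hg.hasLineDerivAt l i hx hl hz)

lemma HasIterPartials.zero : HasIterPartials e U z k (fun _ => (0 : W)) := by
  have h : ∀ l : List ι, iterPartial e (fun _ => (0 : W)) l = fun _ => 0 := by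
    intro l
    induction l with
    | nil => rfl
    | cons i l ih =>
      funext x
      simp only [iterPartial, ih]
      simp [lineDeriv]
  intro l i x _ _ _
  rw [h]
  exact differentiableAt_const (0 : W)

lemma HasIterPartials.sum (hU : 0 < k → IsOpen U) {J : Type*} (s : Finset J) {F : J → V → W}
    (hF : ∀ j ∈ s, HasIterPartials e U z k (F j)) :
    HasIterPartials e U z k (fun x => ∑ j ∈ s, F j x) := by
  classical
  induction s using Finset.induction_on with
  | empty => simpa using HasIterPartials.zero
  | insert j s hj ih =>
    simp only [Finset.sum_insert hj]
    exact (HasIterPartials.add hU (hF j (by simp))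
      (ih fun i hi => hF i (Finset.mem_insert_of_mem hi))).1

lemma HasIterPartials.const_mul (hU : 0 < k → IsOpen U) {f : V → ℝ}
    (hf : HasIterPartials e U z k f) (c : ℝ) : HasIterPartials e U z k (fun x => c * f x) :=
  (hf.clm_comp hU (c • ContinuousLinearMap.id ℝ ℝ)).1

lemma ContDiff.hasIterPartials (hf : ContDiff ℝ ⊤ f) : HasIterPartials e U z k f := by
  have h : ∀ l : List ι, ContDiff ℝ ⊤ (iterPartial e f l) := by
    intro l
    induction l with
    | nil => exact hf
    | cons i l ih =>
      have h1 : iterPartial e f (i :: l) = fun x => fderiv ℝ (iterPartial e f l) x (e i) := by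
        funext x
        exact (ih.differentiable (by simp) x).lineDeriv_eq_fderiv
      rw [h1]
      exact (ih.fderiv_right (m := ⊤) (by simp)).clm_apply contDiff_const
  exact fun l i x _ _ _ => ((h l).differentiable (by simp) x).lineDifferentiableAt

lemma HasIterPartials.iterDerivExistsAt {V : Type} [NormedAddCommGroup V] [NormedSpace ℝ V]
    {e : ι → V} {U : Set V} {z : V} {f : V → ℝ} (hU : 0 < k → IsOpen U)
    (hf : HasIterPartials e U z k f) (l : List ι) :
    ∀ x ∈ U, l.length ≤ k → (x = z ∨ l.length < k) → IterDerivExistsAt f (l.map e) x := by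
  induction l with
  | nil => exact fun _ _ _ _ => trivial
  | cons i l ih =>
    intro x hx hl hz
    simp only [List.length_cons] at hl hz
    refine ⟨?_, ?_⟩
    · filter_upwards [(hU (by omega)).mem_nhds hx] with y hy
      exact ih y hy (by omega) (by omega)
    · rw [iterDeriv_map_eq_iterPartial]
      exact hf l i x hx (by omega) hz

/-! ### Mean value theorem for directional derivatives -/

/-- Scaling the segment to the parameter interval `[0, 1]` covers every sign of `t`, including `t =
0`. -/
lemma exists_lineDeriv_eq_sub {f : V → ℝ} {x v : V} {t : ℝ}
    (hf : ∀ s ∈ Set.Icc (0 : ℝ) 1, LineDifferentiableAt ℝ f (x + (s * t) • v) v) :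
    ∃ s ∈ Set.Ioo (0 : ℝ) 1, f (x + t • v) - f x = t * lineDeriv ℝ f (x + (s * t) • v) v := by
  have hd : ∀ s ∈ Set.Icc (0 : ℝ) 1, HasDerivAt (fun s : ℝ => f (x + (s * t) • v))
      (t * lineDeriv ℝ f (x + (s * t) • v) v) s := by
    intro s hs
    have h1 : HasDerivAt (fun r : ℝ => f (x + (s * t) • v + r • v))
        (lineDeriv ℝ f (x + (s * t) • v) v) ((s - s) * t) := by
      rw [sub_self, zero_mul]
      exact (hf s hs).hasLineDerivAt
    have h2 : HasDerivAt (fun r : ℝ => (r - s) * t) t s := by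
      simpa using ((hasDerivAt_id s).sub_const s).mul_const t
    have h3 := h1.comp s h2
    rw [mul_comm (lineDeriv ℝ f _ v)] at h3
    refine h3.congr_of_eventuallyEq (Eventually.of_forall fun r => ?_)
    simp only [Function.comp]
    congr 1
    rw [add_assoc, ← add_smul]
    congr 2
    ring
  obtain ⟨s, hs, h⟩ := exists_hasDerivAt_eq_slope (fun s : ℝ => f (x + (s * t) • v))
    (fun s => t * lineDeriv ℝ f (x + (s * t) • v) v) zero_lt_one
    (fun s hs => (hd s hs).continuousAt.continuousWithinAt)
    (fun s hs => hd s (Set.Ioo_subset_Icc_self hs))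
  refine ⟨s, hs, ?_⟩
  simpa using h.symm

/-- The second mixed difference quotients of `F` converge to the mixed derivative, if that is
continuous at the point in question. -/
lemma tendsto_mixed_slope {V' : Type*} [NormedAddCommGroup V'] [NormedSpace ℝ V']
    {F : V × V' → ℝ} {x : V} {y : V'} {v : V} {w : V'}
    (h₁ : ∀ᶠ p in 𝓝 (x, y), LineDifferentiableAt ℝ F p (v, 0))
    (h₂ : ∀ᶠ p in 𝓝 (x, y), LineDifferentiableAt ℝ (fun p => lineDeriv ℝ F p (v, 0)) p (0, w))
    (hc : ContinuousAt (fun p => lineDeriv ℝ (fun p => lineDeriv ℝ F p (v, 0)) p (0, w)) (x, y)) :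
    Tendsto (fun τ : ℝ × ℝ => τ.1⁻¹ * τ.2⁻¹ * (F (x + τ.1 • v, y + τ.2 • w) - F (x + τ.1 • v, y)
      - (F (x, y + τ.2 • w) - F (x, y)))) (𝓝[≠] 0 ×ˢ 𝓝[≠] 0)
      (𝓝 (lineDeriv ℝ (fun p => lineDeriv ℝ F p (v, 0)) (x, y) (0, w))) := by
  set M : V × V' → ℝ := fun p => lineDeriv ℝ (fun p => lineDeriv ℝ F p (v, 0)) p (0, w) with hM
  rw [Metric.tendsto_nhds]
  intro ε hε
  have hev : ∀ᶠ p in 𝓝 (x, y), LineDifferentiableAt ℝ F p (v, 0) ∧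
      LineDifferentiableAt ℝ (fun p => lineDeriv ℝ F p (v, 0)) p (0, w) ∧
      dist (M p) (M (x, y)) < ε :=
    h₁.and (h₂.and (Metric.tendsto_nhds.1 hc ε hε))
  have hcont : Continuous fun τ : ℝ × ℝ => (x + τ.1 • v, y + τ.2 • w) := by fun_prop
  have hev' := hcont.continuousAt.tendsto (x := (0, 0)) |>.eventually
    (p := fun p => LineDifferentiableAt ℝ F p (v, 0) ∧
      LineDifferentiableAt ℝ (fun p => lineDeriv ℝ F p (v, 0)) p (0, w) ∧
      dist (M p) (M (x, y)) < ε) (by simpa using hev)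
  obtain ⟨δ, hδ, hball⟩ := Metric.eventually_nhds_iff.1 hev'
  have hbox : ∀ r s : ℝ, |r| < δ → |s| < δ → LineDifferentiableAt ℝ F (x + r • v, y + s • w) (v, 0) ∧
      LineDifferentiableAt ℝ (fun p => lineDeriv ℝ F p (v, 0)) (x + r • v, y + s • w) (0, w) ∧
      dist (M (x + r • v, y + s • w)) (M (x, y)) < ε := fun r s hr hs =>
    hball (y := (r, s)) (by simp [Prod.dist_eq, hr, hs])
  have hsmall : ∀ᶠ t : ℝ in 𝓝[≠] 0, |t| < δ ∧ t ≠ 0 := by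
    refine Eventually.and ?_ eventually_mem_nhdsWithin
    refine eventually_nhdsWithin_of_eventually_nhds ?_
    simpa [Real.norm_eq_abs] using eventually_norm_sub_lt (0 : ℝ) hδ
  filter_upwards [hsmall.prod_mk hsmall] with ⟨t, t'⟩ ⟨⟨ht, ht0⟩, ⟨ht', ht0'⟩⟩
  have hmul : ∀ s ∈ Set.Icc (0 : ℝ) 1, ∀ r : ℝ, |r| < δ → |s * r| < δ := by
    intro s hs r hr
    rw [abs_mul, abs_of_nonneg hs.1]
    exact lt_of_le_of_lt (mul_le_of_le_one_left (abs_nonneg r) hs.2) hr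
  have hx1 : ∀ (u : V) (q : V') (r : ℝ), (u, q) + r • ((v, 0) : V × V') = (u + r • v, q) := by
    intro u q r; simp
  have hx2 : ∀ (u : V) (q : V') (r : ℝ), (u, q) + r • ((0, w) : V × V') = (u, q + r • w) := by
    intro u q r; simp
  have hφ : ∀ (b : ℝ), |b| < δ → ∀ s ∈ Set.Icc (0 : ℝ) 1,
      LineDifferentiableAt ℝ F ((x, y + b • w) + (s * t) • ((v, 0) : V × V')) (v, 0) := by
    intro b hb s hs
    rw [hx1]
    exact (hbox (s * t) b (hmul s hs t ht) hb).1
  -- The mean value theorem is applied to the increment in the second argument, as a function of the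
  -- first, and then to `∂_v F` in the second argument. The quotient becomes a value of the mixed
  -- derivative at an intermediate point.
  obtain ⟨s, hs, h⟩ := exists_lineDeriv_eq_sub (V := V)
    (f := fun u => F (u, y + t' • w) - F (u, y)) (x := x) (v := v) (t := t) (by
      intro s hs
      have ha := hφ t' ht' s hs
      have hb := hφ 0 (by simpa using hδ) s hs
      rw [hx1] at ha hb
      have ha' := ha.hasLineDerivAt
      have hb' := hb.hasLineDerivAt
      simp only [HasLineDerivAt, hx1, zero_smul, add_zero] at ha' hb'
      exact (HasDerivAt.fun_sub ha' hb').differentiableAt)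
  have hs' := Set.Ioo_subset_Icc_self hs
  have hline : lineDeriv ℝ (fun u => F (u, y + t' • w) - F (u, y)) (x + (s * t) • v) v =
      lineDeriv ℝ F (x + (s * t) • v, y + t' • w) (v, 0) -
        lineDeriv ℝ F (x + (s * t) • v, y) (v, 0) := by
    have ha := hφ t' ht' s hs'
    have hb := hφ 0 (by simpa using hδ) s hs'
    rw [hx1] at ha hb
    have ha' := ha.hasLineDerivAt
    have hb' := hb.hasLineDerivAt
    simp only [HasLineDerivAt, hx1, zero_smul, add_zero] at ha' hb'
    exact (HasDerivAt.fun_sub ha' hb').deriv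
  obtain ⟨r, hr, h'⟩ := exists_lineDeriv_eq_sub (V := V × V')
    (f := fun p => lineDeriv ℝ F p (v, 0)) (x := (x + (s * t) • v, y)) (v := (0, w)) (t := t') (by
      intro r hr
      rw [hx2]
      exact (hbox _ _ (hmul s hs' t ht) (hmul r hr t' ht')).2.1)
  rw [hx2, hx2] at h'
  rw [hline, h'] at h
  have hfin := (hbox _ _ (hmul s hs' t ht) (hmul r (Set.Ioo_subset_Icc_self hr) t' ht')).2.2
  have heq : t⁻¹ * t'⁻¹ * (F (x + t • v, y + t' • w) - F (x + t • v, y)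
      - (F (x, y + t' • w) - F (x, y))) = M (x + (s * t) • v, y + (r * t') • w) := by
    rw [h]
    field_simp
    rfl
  simpa only [heq] using hfin

/-- A function with bounded partial derivatives on an open set is continuous there. -/
lemma continuousAt_of_bounded_lineDeriv [Fintype ι] {F : V → ℝ} {φ : ι → V →L[ℝ] ℝ}
    (hφ : ∀ h, ∑ i, φ i h • e i = h) {O : Set V} (hO : IsOpen O) {C : ℝ}
    (hd : ∀ p ∈ O, ∀ i, LineDifferentiableAt ℝ F p (e i))
    (hC : ∀ p ∈ O, ∀ i, |lineDeriv ℝ F p (e i)| ≤ C) {p : V} (hp : p ∈ O) :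
    ContinuousAt F p := by
  classical
  -- The increment is built up one direction at a time, each costing at most `C * |φ i h|`.
  -- Compactness of `[0, 1]` keeps the connecting segments inside `O`.
  have key : ∀ s : Finset ι, Tendsto (fun h => F (p + ∑ i ∈ s, φ i h • e i)) (𝓝 0) (𝓝 (F p)) := by
    intro s
    induction s using Finset.induction_on with
    | empty => simp
    | insert i s hi ih =>
      have hev : ∀ᶠ h in 𝓝 (0 : V), ∀ r ∈ Set.Icc (0 : ℝ) 1,
          p + ∑ i ∈ s, φ i h • e i + (r * φ i h) • e i ∈ O := by
        have hc : Continuous fun q : V × ℝ => p + ∑ i ∈ s, φ i q.1 • e i + (q.2 * φ i q.1) • e i := by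
          fun_prop
        have hn : ∀ r ∈ Set.Icc (0 : ℝ) 1, ∀ᶠ q : V × ℝ in 𝓝 (0, r),
            p + ∑ i ∈ s, φ i q.1 • e i + (q.2 * φ i q.1) • e i ∈ O := by
          intro r _
          exact hc.continuousAt.eventually_mem (by simpa using hO.mem_nhds hp)
        exact isCompact_Icc.eventually_forall_of_forall_eventually hn
      have hle : ∀ᶠ h in 𝓝 (0 : V), |F (p + ∑ j ∈ insert i s, φ j h • e j)
          - F (p + ∑ j ∈ s, φ j h • e j)| ≤ C * |φ i h| := by
        filter_upwards [hev] with h hh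
        obtain ⟨r, hr, heq⟩ := exists_lineDeriv_eq_sub (f := F) (x := p + ∑ j ∈ s, φ j h • e j)
          (v := e i) (t := φ i h) fun r hr => hd _ (hh r hr) i
        rw [Finset.sum_insert hi, add_comm (φ i h • e i), ← add_assoc, heq, abs_mul, mul_comm C]
        exact mul_le_mul_of_nonneg_left (hC _ (hh r (Set.Ioo_subset_Icc_self hr)) i) (abs_nonneg _)
      have hz : Tendsto (fun h => C * |φ i h|) (𝓝 0) (𝓝 0) := by
        have : Continuous fun h => C * |φ i h| := by fun_prop
        simpa using this.tendsto 0
      have h0 := squeeze_zero_norm' (f := fun h => F (p + ∑ j ∈ insert i s, φ j h • e j)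
        - F (p + ∑ j ∈ s, φ j h • e j)) hle hz
      simpa using h0.add ih
  have h := key Finset.univ
  simp only [hφ] at h
  have h2 : Tendsto (fun x => x - p) (𝓝 p) (𝓝 0) := by
    have : Continuous fun x : V => x - p := by fun_prop
    simpa using this.tendsto p
  simpa [Function.comp_def, ContinuousAt] using h.comp h2

end IteratedPartials

/-! ### Differentiability of Hilbert space-valued maps from their Gram kernel -/

section Gram

/-- The joint limit also applies to diagonal pairs, so expanding `‖q τ.1 - q τ.2‖ ^ 2` gives the
limit `c - 2 * c + c = 0`, and completeness applies. -/
lemma exists_tendsto_of_tendsto_inner {H α : Type*} [NormedAddCommGroup H] [InnerProductSpace ℝ H]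
    [CompleteSpace H] {l : Filter α} [l.NeBot] {q : α → H} {c : ℝ}
    (h : Tendsto (fun τ : α × α => inner ℝ (q τ.1) (q τ.2)) (l ×ˢ l) (𝓝 c)) :
    ∃ m, Tendsto q l (𝓝 m) := by
  rw [← cauchy_map_iff_exists_tendsto, cauchy_map_iff]
  refine ⟨inferInstance, ?_⟩
  have h1 : Tendsto (fun τ : α × α => inner ℝ (q τ.1) (q τ.1)) (l ×ˢ l) (𝓝 c) :=
    h.comp (f := fun τ : α × α => (τ.1, τ.1)) (tendsto_fst.prodMk tendsto_fst)
  have h2 : Tendsto (fun τ : α × α => inner ℝ (q τ.2) (q τ.2)) (l ×ˢ l) (𝓝 c) :=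
    h.comp (f := fun τ : α × α => (τ.2, τ.2)) (tendsto_snd.prodMk tendsto_snd)
  have h3 : Tendsto (fun τ : α × α => ‖q τ.1 - q τ.2‖ ^ 2) (l ×ˢ l) (𝓝 0) := by
    have := (h1.sub (h.const_mul 2)).add h2
    refine (this.congr fun τ => ?_).trans (by ring_nf; exact le_rfl)
    rw [norm_sub_sq_real, real_inner_self_eq_norm_sq, real_inner_self_eq_norm_sq]
  have h4 := h3.sqrt
  simp only [Real.sqrt_sq (norm_nonneg _), Real.sqrt_zero] at h4
  rw [tendsto_uniformity_iff_dist_tendsto_zero]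
  simpa only [dist_eq_norm] using h4

variable {ι J V H : Type*} [NormedAddCommGroup V] [NormedSpace ℝ V]
  [NormedAddCommGroup H] [InnerProductSpace ℝ H] [Fintype J]

/-- The directions in a product space given by directions in the factors. -/
def prodDir (e : ι → V) : ι ⊕ ι → V × V := Sum.elim (fun i => (e i, 0)) (fun i => (0, e i))

variable {e : ι → V} {U : Set V} {z : V} {k n : ℕ} {E : V → H} {F : V × V → ℝ} {a b : J → V → ℝ}

lemma HasLineDerivAt.comp_prodMk_left {F : V × V → ℝ} {c : ℝ} {x y v : V}
    (h : HasLineDerivAt ℝ F c (x, y) (0, v)) : HasLineDerivAt ℝ (fun y => F (x, y)) c y v := by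
  simpa [HasLineDerivAt] using h

lemma HasLineDerivAt.comp_prodMk_right {F : V × V → ℝ} {c : ℝ} {x y v : V}
    (h : HasLineDerivAt ℝ F c (x, y) (v, 0)) : HasLineDerivAt ℝ (fun x => F (x, y)) c x v := by
  simpa [HasLineDerivAt] using h

lemma HasLineDerivAt.sum_mul {W : Type*} [NormedAddCommGroup W] [NormedSpace ℝ W]
    {f : W → ℝ} {f' : ℝ} {x v : W} (hf : HasLineDerivAt ℝ f f' x v)
    {g : J → W → ℝ} {g' : J → ℝ} (hg : ∀ j, HasLineDerivAt ℝ (g j) (g' j) x v) (c : J → ℝ) :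
    HasLineDerivAt ℝ (fun y => f y + ∑ j, c j * g j y) (f' + ∑ j, c j * g' j) x v :=
  HasDerivAt.fun_add hf (HasDerivAt.fun_sum fun j _ => HasDerivAt.const_mul (c j) (hg j))

/-- If the Gram kernel `⟪E x, E y⟫` is `F (x, y) + ∑ j, a j x * b j y`, then the Gram kernel of the
derivatives of `E` is obtained by differentiation. -/
lemma inner_iterPartial (hU : IsOpen U)
    (hG : ∀ x ∈ U, ∀ y ∈ U, inner ℝ (E x) (E y) = F (x, y) + ∑ j, a j x * b j y)
    (hE : ∀ (l : List ι) (i : ι), ∀ x ∈ U, l.length < n →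
      LineDifferentiableAt ℝ (iterPartial e E l) x (e i))
    (ha : ∀ j (l : List ι) (i : ι), ∀ x ∈ U, l.length < n →
      LineDifferentiableAt ℝ (iterPartial e (a j) l) x (e i))
    (hb : ∀ j (l : List ι) (i : ι), ∀ x ∈ U, l.length < n →
      LineDifferentiableAt ℝ (iterPartial e (b j) l) x (e i))
    (hF : ∀ (l : List (ι ⊕ ι)) (c : ι ⊕ ι), ∀ p ∈ U ×ˢ U, (c :: l).countP Sum.isLeft ≤ n →
      (c :: l).countP Sum.isRight ≤ n →
      LineDifferentiableAt ℝ (iterPartial (prodDir e) F l) p (prodDir e c))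
    (l l' : List ι) (hl : l.length ≤ n) (hl' : l'.length ≤ n) :
    ∀ x ∈ U, ∀ y ∈ U, inner ℝ (iterPartial e E l x) (iterPartial e E l' y) =
      iterPartial (prodDir e) F (l.map Sum.inl ++ l'.map Sum.inr) (x, y) +
        ∑ j, iterPartial e (a j) l x * iterPartial e (b j) l' y := by
  have hcount : ∀ l l' : List ι,
      (l.map Sum.inl ++ l'.map Sum.inr : List (ι ⊕ ι)).countP Sum.isLeft = l.length ∧
      (l.map Sum.inl ++ l'.map Sum.inr : List (ι ⊕ ι)).countP Sum.isRight = l'.length := by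
    intro l l'
    simp [List.countP_append, List.countP_map, Function.comp_def]
  induction l with
  | nil =>
    -- The derivatives in the second argument come first: in the combined list they stand to the
    -- right, hence are the inner ones.
    induction l' with
    | nil => exact hG
    | cons i l' ih =>
      intro x hx y hy
      simp only [List.length_cons] at hl'
      have h1 : HasLineDerivAt ℝ (fun y => inner ℝ (E x) (iterPartial e E l' y))
          (inner ℝ (E x) (iterPartial e E (i :: l') y)) y (e i) :=
        (innerSL ℝ (E x)).hasFDerivAt.comp_hasDerivAt (0 : ℝ)
          (hE l' i y hy (by omega)).hasLineDerivAt
      have hc := hcount [] (i :: l')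
      have h2 := (hF (l'.map Sum.inr) (Sum.inr i) (x, y) ⟨hx, hy⟩
        (by simp [List.countP_map, Function.comp_def])
        (by simpa [List.countP_cons, List.countP_map, Function.comp_def] using hl')).hasLineDerivAt
      have h3 := h2.comp_prodMk_left.sum_mul
        (fun j => (hb j l' i y hy (by omega)).hasLineDerivAt) (fun j => a j x)
      refine h1.unique (h3.congr_of_eventuallyEq ?_)
      filter_upwards [hU.mem_nhds hy] with y hy
      exact ih (by omega) x hx y hy
  | cons i l ih =>
    intro x hx y hy
    simp only [List.length_cons] at hl
    have h1 : HasLineDerivAt ℝ (fun x => inner ℝ (iterPartial e E l' y) (iterPartial e E l x))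
        (inner ℝ (iterPartial e E l' y) (iterPartial e E (i :: l) x)) x (e i) :=
      (innerSL ℝ (iterPartial e E l' y)).hasFDerivAt.comp_hasDerivAt (0 : ℝ)
        (hE l i x hx (by omega)).hasLineDerivAt
    have hc := hcount (i :: l) l'
    simp only [List.map_cons, List.cons_append, List.length_cons] at hc
    have h2 := (hF (l.map Sum.inl ++ l'.map Sum.inr) (Sum.inl i) (x, y) ⟨hx, hy⟩
      (by omega) (by omega)).hasLineDerivAt
    have h3 := h2.comp_prodMk_right.sum_mul
      (fun j => (ha j l i x hx (by omega)).hasLineDerivAt) (fun j => iterPartial e (b j) l' y)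
    rw [real_inner_comm]
    have h4 := h1.unique (h3.congr_of_eventuallyEq ?_)
    · rw [h4]
      congr 1
      exact Finset.sum_congr rfl fun j _ => mul_comm _ _
    · filter_upwards [hU.mem_nhds hx] with x hx
      rw [real_inner_comm, ih (by omega) x hx y hy]
      congr 1
      exact Finset.sum_congr rfl fun j _ => mul_comm _ _

/-- A Hilbert space-valued map is as often differentiable as its Gram kernel is in each of its two
arguments. -/
theorem hasIterPartials_of_gram [CompleteSpace H] (hU : 0 < k → IsOpen U)
    (hG : ∀ x ∈ U, ∀ y ∈ U, inner ℝ (E x) (E y) = F (x, y) + ∑ j, a j x * b j y)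
    (ha : ∀ j, HasIterPartials e U z k (a j)) (hb : ∀ j, HasIterPartials e U z k (b j))
    (hF : ∀ (l : List (ι ⊕ ι)) (c : ι ⊕ ι), ∀ p ∈ U ×ˢ U, (c :: l).countP Sum.isLeft ≤ k →
      (c :: l).countP Sum.isRight ≤ k →
      LineDifferentiableAt ℝ (iterPartial (prodDir e) F l) p (prodDir e c))
    (hFc : ∀ l : List (ι ⊕ ι), l ≠ [] → l.countP Sum.isLeft ≤ k → l.countP Sum.isRight ≤ k →
      ∀ x ∈ U, (x = z ∨ l.countP Sum.isLeft < k ∧ l.countP Sum.isRight < k) →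
      ContinuousAt (iterPartial (prodDir e) F l) (x, x)) :
    HasIterPartials e U z k E := by
  suffices h : ∀ n, ∀ (l : List ι) (i : ι), ∀ x ∈ U, l.length = n → n < k → (x = z ∨ n + 1 < k) →
      LineDifferentiableAt ℝ (iterPartial e E l) x (e i) from
    fun l i x hx hl hz => h _ l i x hx rfl hl hz
  intro n
  induction n using Nat.strong_induction_on with
  | _ n ih =>
  intro l i x hx hl hn hz
  have hUo := hU (by omega)
  -- Since `n < k`, all derivatives of `E` of order at most `n` exist on the whole of `U`, so their
  -- Gram kernel is known there.
  have hgram := inner_iterPartial (n := n) hUo hG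
    (fun l i x hx hl => ih _ hl l i x hx rfl (by omega) (by omega))
    (fun j l i x hx hl => ha j l i x hx (by omega) (by omega))
    (fun j l i x hx hl => hb j l i x hx (by omega) (by omega))
    (fun l c p hp h1 h2 => hF l c p hp (by omega) (by omega)) l l hl.le hl.le
  set D := iterPartial e E l with hD
  set L : List (ι ⊕ ι) := l.map Sum.inl ++ l.map Sum.inr with hL
  have hc1 : L.countP Sum.isLeft = n := by
    simp [hL, List.countP_append, List.countP_map, Function.comp_def, hl]
  have hc2 : L.countP Sum.isRight = n := by
    simp [hL, List.countP_append, List.countP_map, Function.comp_def, hl]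
  have hUU : U ×ˢ U ∈ 𝓝 (x, x) := (hUo.prod hUo).mem_nhds ⟨hx, hx⟩
  have hm := tendsto_mixed_slope (F := iterPartial (prodDir e) F L) (x := x) (y := x)
    (v := e i) (w := e i)
    (by filter_upwards [hUU] with p hp
        exact hF L (Sum.inl i) p hp (by simp [List.countP_cons, hc1]; omega)
          (by simp [hc2]; omega))
    (by filter_upwards [hUU] with p hp
        exact hF (Sum.inl i :: L) (Sum.inr i) p hp (by simp [List.countP_cons, hc1]; omega)
          (by simp [List.countP_cons, hc2]; omega))
    -- This derivative has order `n + 1` in each argument. For `n + 1 = k` it is known to be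
    -- continuous only at `(z, z)`, which is why order `k` is claimed only at `z`.
    (hFc (Sum.inr i :: Sum.inl i :: L) (by simp) (by simp [List.countP_cons, hc1]; omega) (by simp [List.countP_cons, hc2]; omega)
      x hx (by simp [List.countP_cons, hc1, hc2]; exact hz))
  have hslope : ∀ (f : V → ℝ), HasIterPartials e U z k f →
      Tendsto (fun t : ℝ => t⁻¹ * (iterPartial e f l (x + t • e i) - iterPartial e f l x)) (𝓝[≠] 0)
        (𝓝 (iterPartial e f (i :: l) x)) := fun f hf =>
    hasLineDerivAt_iff_tendsto_slope_zero.1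
      (hf.hasLineDerivAt l i hx (by omega) (by rw [hl]; exact hz))
  have hsum := tendsto_finsetSum Finset.univ fun (j : J) _ =>
    ((hslope _ (ha j)).comp tendsto_fst).mul ((hslope _ (hb j)).comp (tendsto_snd (f := 𝓝[≠] (0 : ℝ))))
  have htot := hm.add hsum
  have hmem : ∀ᶠ t : ℝ in 𝓝[≠] 0, x + t • e i ∈ U :=
    eventually_nhdsWithin_of_eventually_nhds (eventually_mem_line hUo hx (e i))
  obtain ⟨m, hm⟩ := exists_tendsto_of_tendsto_inner (l := 𝓝[≠] (0 : ℝ))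
    (q := fun t => t⁻¹ • (D (x + t • e i) - D x)) (htot.congr' (by
      filter_upwards [hmem.prod_mk hmem] with ⟨t, t'⟩ ⟨ht, ht'⟩
      simp only [Function.comp]
      rw [real_inner_smul_left, real_inner_smul_right, inner_sub_left, inner_sub_right,
        inner_sub_right, hgram _ ht _ ht', hgram _ ht _ hx, hgram _ hx _ ht', hgram _ hx _ hx]
      have : ∀ j, t⁻¹ * (iterPartial e (a j) l (x + t • e i) - iterPartial e (a j) l x) *
          (t'⁻¹ * (iterPartial e (b j) l (x + t' • e i) - iterPartial e (b j) l x)) =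
          t⁻¹ * t'⁻¹ * (iterPartial e (a j) l (x + t • e i) * iterPartial e (b j) l (x + t' • e i)
          - iterPartial e (a j) l (x + t • e i) * iterPartial e (b j) l x
          - (iterPartial e (a j) l x * iterPartial e (b j) l (x + t' • e i)
          - iterPartial e (a j) l x * iterPartial e (b j) l x)) := fun j => by ring
      simp only [this, ← Finset.mul_sum, Finset.sum_sub_distrib]
      ring))
  exact (hasLineDerivAt_iff_tendsto_slope_zero.2 hm).lineDifferentiableAt

end Gram

/-! ### Interpolation by polynomials -/

section Interpolation

/-- A finite-dimensional space of functions is determined by finitely many point values, taken from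
any given determining set. -/
lemma exists_finset_interpolation {X : Type*} (V : Submodule ℝ (X → ℝ)) [FiniteDimensional ℝ V]
    {S : Set X} (hS : ∀ v ∈ V, (∀ x ∈ S, v x = 0) → v = 0) :
    ∃ (T : Finset X) (P : T → X → ℝ), (∀ t ∈ T, t ∈ S) ∧ (∀ t, P t ∈ V) ∧
      ∀ v ∈ V, ∀ x, v x = ∑ t : T, P t x * v t := by
  classical
  let N : Finset X → Submodule ℝ V := fun T =>
    ⨅ t ∈ T, LinearMap.ker ((LinearMap.proj (R := ℝ) (φ := fun _ : X => ℝ) t).comp V.subtype)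
  have hN : ∀ (T : Finset X) (v : V), v ∈ N T ↔ ∀ t ∈ T, v.1 t = 0 := by
    intro T v
    simp [N, Submodule.mem_iInf]
  -- Take `T ⊆ S` with minimal space of functions vanishing on it. Adding a further point of `S`
  -- cannot shrink that space, so its members vanish on all of `S`.
  obtain ⟨_, ⟨T, hTS, rfl⟩, hmin⟩ := IsArtinian.set_has_minimal
    {M : Submodule ℝ V | ∃ T : Finset X, (∀ t ∈ T, t ∈ S) ∧ N T = M} ⟨N ∅, ∅, by simp, rfl⟩
  have hbot : ∀ v ∈ N T, v = 0 := by
    intro v hv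
    refine Subtype.ext (hS v.1 v.2 fun x hx => ?_)
    have hle : N (insert x T) ≤ N T := fun u hu =>
      (hN _ _).2 fun t ht => (hN _ _).1 hu t (Finset.mem_insert_of_mem ht)
    have hge : N T ≤ N (insert x T) := by
      by_contra hne
      exact hmin _ ⟨insert x T, by simpa using ⟨hx, hTS⟩, rfl⟩ (lt_of_le_not_ge hle hne)
    exact (hN _ _).1 (hge hv) x (Finset.mem_insert_self x T)
  let A : V →ₗ[ℝ] (T → ℝ) := LinearMap.pi fun t =>
    (LinearMap.proj (R := ℝ) (φ := fun _ : X => ℝ) t.1).comp V.subtype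
  have hA : LinearMap.ker A = ⊥ := by
    refine (Submodule.eq_bot_iff _).2 fun v hv => hbot v ((hN _ _).2 fun t ht => ?_)
    exact congrFun (LinearMap.mem_ker.1 hv) ⟨t, ht⟩
  -- A left inverse of evaluation on `T` suffices: reproduction on `V` is needed, not interpolation
  -- of arbitrary data.
  obtain ⟨L, hL⟩ := A.exists_leftInverse_of_injective hA
  refine ⟨T, fun t => (L (Pi.single t 1)).1, hTS, fun t => (L _).2, fun v hv x => ?_⟩
  have h1 : L (A ⟨v, hv⟩) = ⟨v, hv⟩ := congrArg (fun B => B ⟨v, hv⟩) hL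
  rw [pi_eq_sum_univ' (A ⟨v, hv⟩), map_sum] at h1
  have h2 := congrFun (congrArg (fun u : V => u.1) h1) x
  simp only [map_smul, AddSubmonoidClass.coe_finsetSum, Submodule.coe_smul, Finset.sum_apply,
    Pi.smul_apply, smul_eq_mul] at h2
  rw [← h2]
  refine Finset.sum_congr rfl fun t _ => ?_
  rw [mul_comm]
  congr 3

variable {d s : ℕ} {Ω : Set (Eucl d)}

instance : FiniteDimensional ℝ (polySpace d s) := by
  have : Finite {n : Fin d →₀ ℕ | n.degree < s} := Finsupp.finite_of_degree_lt s
  exact Module.Finite.of_basis (MvPolynomial.basisRestrictSupport ℝ {n : Fin d →₀ ℕ | n.degree < s})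

/-- The linear map taking a polynomial to its restriction to `Ω`. -/
def polyFunHom (Ω : Set (Eucl d)) : MvPolynomial (Fin d) ℝ →ₗ[ℝ] (Ω → ℝ) where
  toFun := polyFun Ω
  map_add' p q := by funext x; simp [polyFun]
  map_smul' r p := by funext x; simp [polyFun, MvPolynomial.smul_eval]

/-- The argument runs in the space of restrictions to `Ω`, since a nonzero polynomial may vanish on
`Ω`. -/
lemma exists_polynomial_interpolation {U : Set (Eucl d)}
    (hU : ∀ p, (∀ x : Ω, x.1 ∈ U → polyFun Ω p x = 0) → ∀ x, polyFun Ω p x = 0) :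
    ∃ (T : Finset Ω) (P : T → MvPolynomial (Fin d) ℝ), (∀ t ∈ T, t.1 ∈ U) ∧
      (∀ t, P t ∈ polySpace d s) ∧
      ∀ q ∈ polySpace d s, ∀ x, polyFun Ω q x = ∑ t : T, polyFun Ω (P t) x * polyFun Ω q t := by
  obtain ⟨T, P, hT, hP, h⟩ := exists_finset_interpolation ((polySpace d s).map (polyFunHom Ω))
    (S := {x | x.1 ∈ U}) (by
      rintro _ ⟨p, -, rfl⟩ h0
      exact funext (hU p h0))
  choose Q hQ hQP using fun t => Submodule.mem_map.1 (hP t)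
  refine ⟨T, Q, hT, hQ, fun q hq x => ?_⟩
  have := h _ (Submodule.mem_map_of_mem hq) x
  simp only [← hQP] at this
  exact this

lemma polyFun_eq_zero_of_isOpen {U : Set (Eucl d)} (hU : IsOpen U) (hne : U.Nonempty)
    (hUΩ : U ⊆ Ω) {p : MvPolynomial (Fin d) ℝ} (hp : ∀ x : Ω, x.1 ∈ U → polyFun Ω p x = 0) :
    p = 0 := by
  obtain ⟨z, hz⟩ := hne
  -- In the sup norm, balls are products of intervals, and a polynomial vanishing on a product of
  -- infinite sets is zero.
  have hpre : IsOpen ((WithLp.toLp 2 : (Fin d → ℝ) → Eucl d) ⁻¹' U) :=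
    hU.preimage (PiLp.continuous_toLp 2 _)
  obtain ⟨r, hr, hball⟩ := Metric.isOpen_iff.1 hpre (WithLp.ofLp z) (by simpa using hz)
  refine MvPolynomial.funext_set (fun i => Metric.ball (z i) r) (fun i => ?_) fun x hx => ?_
  · rw [Real.ball_eq_Ioo]
    exact Set.Ioo_infinite (by linarith)
  · have hx' : WithLp.toLp 2 x ∈ U := hball (by rw [ball_pi _ hr]; exact hx)
    simpa [polyFun] using hp ⟨_, hUΩ hx'⟩ hx'

lemma contDiff_mvPolynomial_eval {n : WithTop ℕ∞} (p : MvPolynomial (Fin d) ℝ) :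
    ContDiff ℝ n fun x : Eucl d => MvPolynomial.eval (fun i => x i) p := by
  induction p using MvPolynomial.induction_on with
  | C c => simpa using contDiff_const
  | add p q hp hq => simpa using hp.add hq
  | mul_X p i hp => simpa using hp.mul (contDiff_piLp_apply 2)

end Interpolation

/-! ### A domain on which the kernel is regular -/

section Domain

variable {d s k : ℕ} {Ω : Set (Eucl d)}

lemma prodDir_coordDir : prodDir (coordDir (d := d)) = coordDir₂ := by
  funext c
  cases c <;> rfl

lemma zeroExt_apply (f : Ω → ℝ) (x : Ω) : zeroExt f x.1 = f x :=
  Subtype.val_injective.extend_apply f 0 x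

lemma zeroExt₂_apply (K : Ω → Ω → ℝ) (x : Ω) (y : Eucl d) :
    zeroExt₂ K (x.1, y) = zeroExt (K x) y :=
  zeroExt_apply (fun x => zeroExt (K x) y) x

lemma iterPartial_map_inr {ι V : Type*} [NormedAddCommGroup V] [NormedSpace ℝ V] (e : ι → V)
    (F : V × V → ℝ) (l : List ι) (x y : V) :
    iterPartial (prodDir e) F (l.map Sum.inr) (x, y) = iterPartial e (fun y => F (x, y)) l y := by
  induction l generalizing y with
  | nil => rfl
  | cons i l ih =>
    simp only [List.map_cons, iterPartial, lineDeriv, prodDir, Sum.elim_inr, ← ih]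
    simp

/-- The coordinate functionals of `ℝᵈ × ℝᵈ`. -/
def coordFun₂ : Fin d ⊕ Fin d → (Eucl d × Eucl d) →L[ℝ] ℝ :=
  Sum.elim (fun i => (EuclideanSpace.proj i).comp (ContinuousLinearMap.fst ℝ _ _))
    (fun i => (EuclideanSpace.proj i).comp (ContinuousLinearMap.snd ℝ _ _))

lemma sum_coordFun₂_smul (h : Eucl d × Eucl d) : ∑ c, coordFun₂ c h • coordDir₂ c = h := by
  have h1 : ∀ v : Eucl d, ∑ i, v i • coordDir i = v := by
    intro v
    ext j
    simp [coordDir, Pi.single_apply]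
  rw [Fintype.sum_sum_type]
  ext1
  · simpa [coordFun₂, coordDir₂, Prod.fst_sum, -PiLp.smul_apply] using h1 h.1
  · simpa [coordFun₂, coordDir₂, Prod.snd_sum, -PiLp.smul_apply] using h1 h.2

/-- For `k > 0`, `U` is a small ball on whose square the relevant derivatives exist and those of
positive order are bounded. Continuity is assumed only at `(z, z)`; elsewhere on the diagonal,
derivatives of order below `k` in both arguments are continuous because their own partial
derivatives are bounded. -/
lemma KernelPartialsExistAt.exists_domain {K : Ω → Ω → ℝ} {z : Ω}
    (hK : KernelPartialsExistAt k K z) :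
    ∃ U ⊆ Ω, z.1 ∈ U ∧ (0 < k → IsOpen U) ∧
      (∀ p, (∀ x : Ω, x.1 ∈ U → polyFun Ω p x = 0) → ∀ x, polyFun Ω p x = 0) ∧
      (∀ (l : List (Fin d ⊕ Fin d)) (c : Fin d ⊕ Fin d), ∀ p ∈ U ×ˢ U,
        (c :: l).countP Sum.isLeft ≤ k → (c :: l).countP Sum.isRight ≤ k →
        LineDifferentiableAt ℝ (iterPartial (prodDir coordDir) (zeroExt₂ K) l) p
          (prodDir coordDir c)) ∧
      (∀ l : List (Fin d ⊕ Fin d), l ≠ [] → l.countP Sum.isLeft ≤ k → l.countP Sum.isRight ≤ k →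
        ∀ x ∈ U, (x = z.1 ∨ l.countP Sum.isLeft < k ∧ l.countP Sum.isRight < k) →
        ContinuousAt (iterPartial (prodDir coordDir) (zeroExt₂ K) l) (x, x)) := by
  have hlen : ∀ l : List (Fin d ⊕ Fin d),
      l.length = l.countP Sum.isLeft + l.countP Sum.isRight := by
    intro l
    induction l with
    | nil => rfl
    | cons c l ih => cases c <;> simp [List.countP_cons, ih] <;> omega
  rcases Nat.eq_zero_or_pos k with rfl | hk
  · refine ⟨Ω, subset_rfl, z.2, by simp, fun p hp x => hp x x.2, fun l c p _ h1 h2 => ?_,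
      fun l hl h1 h2 => ?_⟩
    · have := hlen (c :: l)
      simp only [List.length_cons] at this
      omega
    · have := List.length_pos_of_ne_nil hl
      have := hlen l
      omega
  obtain ⟨hΩ, hK⟩ := hK
  -- At most `k` differentiations in each argument leave finitely many lists, hence one common
  -- neighbourhood.
  have hfin : {l : List (Fin d ⊕ Fin d) | l.length ≤ 2 * k}.Finite := List.finite_length_le _ _
  have hev : ∀ᶠ p in 𝓝 (z.1, z.1), ∀ l ∈ {l : List (Fin d ⊕ Fin d) | l.length ≤ 2 * k},
      l.countP Sum.isLeft ≤ k → l.countP Sum.isRight ≤ k →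
      IterDerivExistsAt (zeroExt₂ K) (l.map coordDir₂) p ∧
      (l ≠ [] → |iterPartial coordDir₂ (zeroExt₂ K) l p| ≤
        |iterPartial coordDir₂ (zeroExt₂ K) l (z.1, z.1)| + 1) := by
    rw [hfin.eventually_all]
    intro l _
    by_cases h1 : l.countP Sum.isLeft ≤ k
    swap
    · exact Eventually.of_forall fun p h => absurd h h1
    by_cases h2 : l.countP Sum.isRight ≤ k
    swap
    · exact Eventually.of_forall fun p _ h => absurd h h2
    by_cases h3 : l = []
    · filter_upwards [(hK l h1 h2).1] with p hp _ _ using ⟨hp, fun h => absurd h3 h⟩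
    · have hc := (hK l h1 h2).2 h3
      rw [iterDeriv_map_eq_iterPartial] at hc
      filter_upwards [(hK l h1 h2).1, hc.abs.eventually_le_const (lt_add_one _)] with p hp hp' _ _
        using ⟨hp, fun _ => hp'⟩
  obtain ⟨r, hr, hrad⟩ := Metric.eventually_nhds_iff_ball.1 hev
  obtain ⟨r', hr', hball⟩ := Metric.mem_nhds_iff.1 (hΩ hk)
  set U := Metric.ball z.1 (min r r') with hU
  have hUo : IsOpen U := Metric.isOpen_ball
  have hzU : z.1 ∈ U := Metric.mem_ball_self (lt_min hr hr')
  have hUΩ : U ⊆ Ω := (Metric.ball_subset_ball (min_le_right _ _)).trans hball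
  have hUU : ∀ p ∈ U ×ˢ U, p ∈ Metric.ball (z.1, z.1) r := by
    intro p hp
    rw [← ball_prod_same]
    exact Set.prod_mono (Metric.ball_subset_ball (min_le_left _ _))
      (Metric.ball_subset_ball (min_le_left _ _)) hp
  have hdiff : ∀ (l : List (Fin d ⊕ Fin d)) (c : Fin d ⊕ Fin d), ∀ p ∈ U ×ˢ U,
      (c :: l).countP Sum.isLeft ≤ k → (c :: l).countP Sum.isRight ≤ k →
      LineDifferentiableAt ℝ (iterPartial coordDir₂ (zeroExt₂ K) l) p (coordDir₂ c) := by
    intro l c p hp h1 h2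
    have h := (hrad p (hUU p hp) (c :: l) (by have := hlen (c :: l); simp only [Set.mem_ofPred_eq]; omega)
      h1 h2).1.2
    rwa [iterDeriv_map_eq_iterPartial] at h
  rw [prodDir_coordDir]
  refine ⟨U, hUΩ, hzU, fun _ => hUo, fun p hp x => ?_, hdiff, fun l hl h1 h2 x hx hz => ?_⟩
  · rw [polyFun_eq_zero_of_isOpen hUo ⟨_, hzU⟩ hUΩ hp]
    simp [polyFun]
  · rcases hz with rfl | ⟨h1, h2⟩
    · have := (hK l h1 h2).2 hl
      rwa [iterDeriv_map_eq_iterPartial] at this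
    have hc : ∀ c : Fin d ⊕ Fin d, (c :: l).countP Sum.isLeft ≤ k ∧
        (c :: l).countP Sum.isRight ≤ k := by
      intro c
      cases c <;> simp [List.countP_cons] <;> omega
    refine continuousAt_of_bounded_lineDeriv sum_coordFun₂_smul (hUo.prod hUo)
      (C := ∑ c, (|iterPartial coordDir₂ (zeroExt₂ K) (c :: l) (z.1, z.1)| + 1))
      (fun p hp c => hdiff l c p hp (hc c).1 (hc c).2) (fun p hp c => ?_) ⟨hx, hx⟩
    refine ((hrad p (hUU p hp) (c :: l) ?_ (hc c).1 (hc c).2).2 (by simp)).trans ?_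
    · have := hlen (c :: l)
      have := hc c
      simp only [Set.mem_ofPred_eq]
      omega
    · exact Finset.single_le_sum
        (f := fun c => |iterPartial coordDir₂ (zeroExt₂ K) (c :: l) (z.1, z.1)| + 1)
        (fun c _ => by positivity) (Finset.mem_univ c)

end Domain

/-! ### Representation of the native space by interpolation errors -/

section Representation

variable {d s k N : ℕ} {Ω : Set (Eucl d)} {K : CPDKernel Ω s} {T : Finset Ω}
  {P : T → MvPolynomial (Fin d) ℝ}

lemma polyFun_sum_smul {J : Type*} [Fintype J] (c : J → ℝ) (Q : J → MvPolynomial (Fin d) ℝ)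
    (x : Ω) : polyFun Ω (∑ j, c j • Q j) x = ∑ j, polyFun Ω (Q j) x * c j := by
  simp [polyFun, MvPolynomial.smul_eval, mul_comm]

/-- The functional `f ↦ f x - ∑ t, P t x * f t`, which annihilates the polynomials that are
reproduced by interpolation. -/
def interpError (K : CPDKernel Ω s) (hP : ∀ q ∈ polySpace d s, ∀ x,
    polyFun Ω q x = ∑ t : T, polyFun Ω (P t) x * polyFun Ω q t) (x : Ω) : PreNative K :=
  ⟨Finsupp.single x 1 - ∑ t : T, polyFun Ω (P t) x • Finsupp.single t.1 1, fun q hq => by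
    rw [pointFunctional, map_sub, map_sum]
    simp [hP q hq x]⟩

variable (hP : ∀ q ∈ polySpace d s, ∀ x,
  polyFun Ω q x = ∑ t : T, polyFun Ω (P t) x * polyFun Ω q t)

lemma pointFunctional_interpError (x : Ω) (f : Ω → ℝ) :
    pointFunctional (interpError K hP x).coeff f = f x - ∑ t : T, polyFun Ω (P t) x * f t := by
  change pointFunctional (Finsupp.single x 1 -
    ∑ t : T, polyFun Ω (P t) x • Finsupp.single t.1 1) f = _
  rw [pointFunctional, map_sub, map_sum]
  simp

lemma IsNativeLimit.eq_inner_add {f : Ω → ℝ} {h : NativeCompletion K} (H : IsNativeLimit K f h) :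
    f = fun x => inner ℝ (interpError K hP x : NativeCompletion K) h +
      polyFun Ω (∑ t : T, f t • P t) x := by
  funext x
  rw [← H.pointFunctional_eq, pointFunctional_interpError, polyFun_sum_smul]
  ring

lemma inner_interpError_coe (x : Ω) (b : PreNative K) :
    inner ℝ (interpError K hP x : NativeCompletion K) (b : NativeCompletion K) =
      b.toFun x - ∑ t : T, polyFun Ω (P t) x * b.toFun t := by
  rw [UniformSpace.Completion.inner_coe, ← pointFunctional_interpError hP x b.toFun]
  rfl

lemma isNativeLimit_inner_interpError (hPs : ∀ t, P t ∈ polySpace d s) (h : NativeCompletion K) :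
    IsNativeLimit K (fun x => inner ℝ (interpError K hP x : NativeCompletion K) h) h := by
  obtain ⟨b, hb, hlim⟩ := mem_closure_iff_seq_limit.1
    ((UniformSpace.Completion.denseRange_coe (α := PreNative K)) h)
  choose a ha using hb
  obtain rfl : (fun n => (a n : NativeCompletion K)) = b := funext ha
  -- Subtracting the interpolant on `T` turns convergence in the completion into pointwise
  -- convergence.
  refine ⟨a, fun n => ∑ t : T, (-(a n).toFun t) • P t,
    fun n => Submodule.sum_mem _ fun t _ => Submodule.smul_mem _ _ (hPs t), hlim, fun x => ?_⟩
  refine (tendsto_const_nhds.inner hlim).congr fun n => ?_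
  rw [inner_interpError_coe, polyFun_sum_smul]
  simp [sub_eq_add_neg]

lemma inner_interpError_interpError (x y : Ω) :
    inner ℝ (interpError K hP x : NativeCompletion K) (interpError K hP y : NativeCompletion K) =
      K x y - ∑ t : T, polyFun Ω (P t) y * K x t - ∑ t : T, polyFun Ω (P t) x *
        (K t y - ∑ u : T, polyFun Ω (P u) y * K t u) := by
  rw [inner_interpError_coe]
  simp only [PreNative.toFun, pointFunctional_interpError]

/-- `K y` need not be a native function. What remains beyond a native part and a polynomial is a
combination of the `K t`, whose coefficients are polynomials in `y` and so are killed when the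
functional is applied in `y`. -/
lemma kernel_eq_inner_add (y : Ω) :
    K y = fun x => inner ℝ (interpError K hP x : NativeCompletion K)
      (interpError K hP y : NativeCompletion K) +
      polyFun Ω (∑ t : T, (K t y - ∑ u : T, polyFun Ω (P u) y * K t u) • P t) x +
      ∑ t : T, polyFun Ω (P t) y * K t x := by
  funext x
  rw [inner_interpError_interpError, polyFun_sum_smul, K.symm y x]
  simp only [K.symm x]
  ring

end Representation

/-! ### Error functionals on functions with partial derivatives -/

section ErrorFunctional

variable {d s k N : ℕ} {Ω : Set (Eucl d)} {U : Set (Eucl d)} {a : (Fin d → ℕ) → Eucl d → ℝ} {z : Ω}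
  {x : Fin N → Ω} {w : Fin N → ℝ} {f g : Ω → ℝ}

lemma length_multiIndexList (α : Fin d → ℕ) : (multiIndexList α).length = ∑ i, α i := by
  simp [multiIndexList, List.length_flatMap, List.sum_ofFn, ← List.ofFn_eq_map]

lemma diffOp_eq_sum (f : Eucl d → ℝ) (z : Eucl d) :
    diffOp k a f z = ∑ m ∈ Finset.range (k + 1), ∑ α ∈ Finset.piAntidiag Finset.univ m,
      a α z * iterPartial coordDir f (multiIndexList α) z := by
  simp only [diffOp, multiDeriv, iterDeriv_map_eq_iterPartial]

/-- The derivative part of an error functional, for vector-valued functions. -/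
def vecDiffOp {W : Type*} [NormedAddCommGroup W] [NormedSpace ℝ W] (k : ℕ)
    (a : (Fin d → ℕ) → Eucl d → ℝ) (f : Eucl d → W) (z : Eucl d) : W :=
  ∑ m ∈ Finset.range (k + 1), ∑ α ∈ Finset.piAntidiag Finset.univ m,
    a α z • iterPartial coordDir f (multiIndexList α) z

lemma diffOp_eq_of_iterPartial {W : Type*} [NormedAddCommGroup W] [NormedSpace ℝ W]
    {f : Eucl d → ℝ} {E : Eucl d → W} {z : Eucl d} (L : W →L[ℝ] ℝ)
    (h : ∀ l : List (Fin d), l.length ≤ k →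
      iterPartial coordDir f l z = L (iterPartial coordDir E l z)) :
    diffOp k a f z = L (vecDiffOp k a E z) := by
  rw [diffOp_eq_sum, vecDiffOp, map_sum]
  refine Finset.sum_congr rfl fun m hm => ?_
  rw [map_sum]
  refine Finset.sum_congr rfl fun α hα => ?_
  rw [map_smul, h, smul_eq_mul]
  rw [length_multiIndexList, (Finset.mem_piAntidiag.1 hα).1]
  exact Nat.lt_succ_iff.1 (Finset.mem_range.1 hm)

/-- `f : Ω → ℝ` has partial derivatives of order less than `k` on `U` and of order `k` at `z`. -/
def HasPartialsOn (U : Set (Eucl d)) (k : ℕ) (z : Ω) (f : Ω → ℝ) : Prop :=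
  HasIterPartials coordDir U z.1 k (zeroExt f)

lemma HasPartialsOn.hasPartialsAt (hU : 0 < k → IsOpen U) (hz : z.1 ∈ U) (hf : HasPartialsOn U k z f) :
    HasPartialsAt k f z :=
  fun l hl => hf.iterDerivExistsAt hU l z hz hl (Or.inl rfl)

lemma zeroExt_add (f g : Ω → ℝ) :
    zeroExt (fun x => f x + g x) = fun x => zeroExt f x + zeroExt g x := by
  funext x
  by_cases hx : x ∈ Ω
  · simp only [zeroExt_apply _ ⟨x, hx⟩]
  · have h : ¬∃ y : Ω, y.1 = x := by rintro ⟨y, rfl⟩; exact hx y.2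
    simp [zeroExt, Function.extend_apply' _ _ _ h]

lemma zeroExt_const_mul (c : ℝ) (f : Ω → ℝ) :
    zeroExt (fun x => c * f x) = fun x => c * zeroExt f x := by
  funext x
  by_cases hx : x ∈ Ω
  · simp only [zeroExt_apply _ ⟨x, hx⟩]
  · have h : ¬∃ y : Ω, y.1 = x := by rintro ⟨y, rfl⟩; exact hx y.2
    simp [zeroExt, Function.extend_apply' _ _ _ h]

/-- Additivity requires regularity: a derivative that does not exist has the default value zero. -/
lemma HasPartialsOn.add (hU : 0 < k → IsOpen U) (hz : z.1 ∈ U) (hf : HasPartialsOn U k z f)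
    (hg : HasPartialsOn U k z g) :
    HasPartialsOn U k z (fun x => f x + g x) ∧
      errorFunctional k a z x w (fun x => f x + g x) =
        errorFunctional k a z x w f + errorFunctional k a z x w g := by
  have h := HasIterPartials.add hU hf hg
  refine ⟨by rw [HasPartialsOn, zeroExt_add]; exact h.1, ?_⟩
  have hd : diffOp k a (zeroExt fun x => f x + g x) z.1 =
      diffOp k a (zeroExt f) z.1 + diffOp k a (zeroExt g) z.1 := by
    simp only [diffOp_eq_sum, ← Finset.sum_add_distrib]
    refine Finset.sum_congr rfl fun m hm => Finset.sum_congr rfl fun α hα => ?_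
    have hl : (multiIndexList α).length ≤ k := by
      rw [length_multiIndexList, (Finset.mem_piAntidiag.1 hα).1]
      exact Nat.lt_succ_iff.1 (Finset.mem_range.1 hm)
    rw [zeroExt_add, h.2 _ z hz hl (Or.inl rfl), mul_add]
  simp only [errorFunctional, hd, mul_add, Finset.sum_add_distrib]
  ring

lemma HasPartialsOn.const_mul (hU : 0 < k → IsOpen U) (hz : z.1 ∈ U) (hf : HasPartialsOn U k z f) (c : ℝ) :
    HasPartialsOn U k z (fun x => c * f x) ∧
      errorFunctional k a z x w (fun x => c * f x) = c * errorFunctional k a z x w f := by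
  have h := HasIterPartials.clm_comp hU hf (c • ContinuousLinearMap.id ℝ ℝ)
  have h0 : zeroExt (fun x => c * f x) =
      fun x => (c • ContinuousLinearMap.id ℝ ℝ) (zeroExt f x) := by
    simp [zeroExt_const_mul]
  refine ⟨by rw [HasPartialsOn, h0]; exact h.1, ?_⟩
  have hd : diffOp k a (zeroExt fun x => c * f x) z.1 = c * diffOp k a (zeroExt f) z.1 := by
    simp only [diffOp_eq_sum, Finset.mul_sum]
    refine Finset.sum_congr rfl fun m hm => Finset.sum_congr rfl fun α hα => ?_
    have hl : (multiIndexList α).length ≤ k := by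
      rw [length_multiIndexList, (Finset.mem_piAntidiag.1 hα).1]
      exact Nat.lt_succ_iff.1 (Finset.mem_range.1 hm)
    rw [h0, h.2 _ z hz hl (Or.inl rfl)]
    simp only [smul_apply, ContinuousLinearMap.id_apply, smul_eq_mul]
    ring
  simp only [errorFunctional, hd, mul_sub, Finset.mul_sum]
  congr 1
  exact Finset.sum_congr rfl fun _ _ => by ring

lemma HasPartialsOn.sum_const_mul (hU : 0 < k → IsOpen U) (hz : z.1 ∈ U) {J : Type*} (S : Finset J)
    {F : J → Ω → ℝ} (hF : ∀ j ∈ S, HasPartialsOn U k z (F j)) (c : J → ℝ) :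
    HasPartialsOn U k z (fun x => ∑ j ∈ S, c j * F j x) ∧
      errorFunctional k a z x w (fun x => ∑ j ∈ S, c j * F j x) =
        ∑ j ∈ S, c j * errorFunctional k a z x w (F j) := by
  classical
  induction S using Finset.induction_on with
  | empty =>
    have h0 : zeroExt (fun _ : Ω => (0 : ℝ)) = fun _ => 0 := by
      simpa using zeroExt_const_mul 0 (fun _ : Ω => (0 : ℝ))
    have hr : HasPartialsOn U k z fun _ => (0 : ℝ) := by
      rw [HasPartialsOn, h0]
      exact HasIterPartials.zero
    refine ⟨by simpa using hr, ?_⟩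
    simpa using (hr.const_mul (a := a) (x := x) (w := w) hU hz 0).2
  | insert j S hj ih =>
    have ih' := ih fun i hi => hF i (Finset.mem_insert_of_mem hi)
    have hj' := (hF j (Finset.mem_insert_self j S)).const_mul (a := a) (x := x) (w := w) hU hz (c j)
    have h := hj'.1.add (a := a) (x := x) (w := w) hU hz ih'.1
    simp only [Finset.sum_insert hj]
    exact ⟨h.1, by rw [h.2, hj'.2, ih'.2]⟩

lemma hasPartialsOn_polyFun (hU : 0 < k → IsOpen U) (hUΩ : U ⊆ Ω) (p : MvPolynomial (Fin d) ℝ) :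
    HasPartialsOn U k z (polyFun Ω p) :=
  (HasIterPartials.congr hU (contDiff_mvPolynomial_eval p).hasIterPartials
    fun _ hy => zeroExt_apply _ ⟨_, hUΩ hy⟩).1

/-- The functions `y ↦ ⟪E y, h⟫ + p y` of a Hilbert space-valued map `E` are as regular as `E`, and
the error functional acts on them as an inner product. -/
lemma hasPartialsOn_inner_add_polyFun {H : Type*} [NormedAddCommGroup H] [InnerProductSpace ℝ H]
    {E : Eucl d → H} {E₀ : Ω → H} (hE₀ : ∀ y : Ω, E y = E₀ y)
    (hU : 0 < k → IsOpen U) (hUΩ : U ⊆ Ω) (hz : z.1 ∈ U)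
    (hE : HasIterPartials coordDir U z.1 k E)
    (hw : ∀ p ∈ polySpace d s, errorFunctional k a z x w (polyFun Ω p) = 0)
    (h : H) {p : MvPolynomial (Fin d) ℝ} (hp : p ∈ polySpace d s) :
    HasPartialsOn U k z (fun y => inner ℝ (E₀ y) h + polyFun Ω p y) ∧
      errorFunctional k a z x w (fun y => inner ℝ (E₀ y) h + polyFun Ω p y) =
        inner ℝ (vecDiffOp k a E z - ∑ j, w j • E₀ (x j)) h := by
  have h1 := hE.clm_comp hU (innerSL ℝ h)
  have h2 := HasIterPartials.congr (f := zeroExt fun y => inner ℝ (E₀ y) h) hU h1.1 (by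
    intro y hy
    rw [zeroExt_apply _ ⟨y, hUΩ hy⟩, innerSL_apply_apply, ← hE₀, real_inner_comm])
  have h3 : errorFunctional k a z x w (fun y => inner ℝ (E₀ y) h) =
      inner ℝ (vecDiffOp k a E z - ∑ j, w j • E₀ (x j)) h := by
    rw [errorFunctional, diffOp_eq_of_iterPartial (innerSL ℝ h) (E := E), innerSL_apply_apply,
      inner_sub_left, sum_inner, real_inner_comm]
    · simp only [real_inner_smul_left]
    · intro l hl
      rw [h2.2 l z hz hl (Or.inl rfl), h1.2 l z hz hl (Or.inl rfl)]
  have h4 := HasPartialsOn.add (a := a) (x := x) (w := w) hU hz h2.1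
    (hasPartialsOn_polyFun (z := z) hU hUΩ p)
  exact ⟨h4.1, by rw [h4.2, h3, hw p hp, add_zero]⟩

end ErrorFunctional

/-! ### Regularity of the interpolation errors and the norm formula -/

lemma norm_nativeClass {d s : ℕ} {Ω : Set (Eucl d)} {K : CPDKernel Ω s} (f : NativeSpace K) :
    ‖nativeClass K f‖ = ‖f‖ := by
  have h : ‖nativeClass K f‖ ^ 2 = ‖f‖ ^ 2 := by
    rw [← real_inner_self_eq_norm_sq, ← real_inner_self_eq_norm_sq]
    rfl
  exact (sq_eq_sq₀ (norm_nonneg _) (norm_nonneg _)).1 h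

/-- The interpolation error functionals depend on the point as smoothly as the kernel does. -/
lemma hasIterPartials_interpError {d s k : ℕ} {Ω : Set (Eucl d)} {K : CPDKernel Ω s} {T : Finset Ω}
    {P : T → MvPolynomial (Fin d) ℝ} {U : Set (Eucl d)} {z : Ω} (hU : 0 < k → IsOpen U)
    (hUΩ : U ⊆ Ω) (hT : ∀ t ∈ T, t.1 ∈ U)
    (hP : ∀ q ∈ polySpace d s, ∀ x,
      polyFun Ω q x = ∑ t : T, polyFun Ω (P t) x * polyFun Ω q t)
    (hF : ∀ (l : List (Fin d ⊕ Fin d)) (c : Fin d ⊕ Fin d), ∀ p ∈ U ×ˢ U,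
      (c :: l).countP Sum.isLeft ≤ k → (c :: l).countP Sum.isRight ≤ k →
      LineDifferentiableAt ℝ (iterPartial (prodDir coordDir) (zeroExt₂ K) l) p
        (prodDir coordDir c))
    (hFc : ∀ l : List (Fin d ⊕ Fin d), l ≠ [] → l.countP Sum.isLeft ≤ k →
      l.countP Sum.isRight ≤ k →
      ∀ x ∈ U, (x = z.1 ∨ l.countP Sum.isLeft < k ∧ l.countP Sum.isRight < k) →
      ContinuousAt (iterPartial (prodDir coordDir) (zeroExt₂ K) l) (x, x)) :
    (∀ t ∈ T, HasPartialsOn U k z (K t)) ∧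
    HasIterPartials coordDir U z.1 k
      (Function.extend Subtype.val (fun x : Ω => (interpError K hP x : NativeCompletion K)) 0) := by
  have hKt : ∀ t ∈ T, HasPartialsOn U k z (K t) := by
    -- Here `T ⊆ U` is essential: `(t, y)` lies in `U ×ˢ U`, where the kernel is differentiable.
    intro t ht l i y hy hl _
    have h := (hF (l.map Sum.inr) (Sum.inr i) (t.1, y) ⟨hT t ht, hy⟩
      (by simp [List.countP_map, Function.comp_def])
      (by simpa [List.countP_cons, List.countP_map, Function.comp_def] using hl)).hasLineDerivAt
    have h' := h.comp_prodMk_left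
    simp only [iterPartial_map_inr, zeroExt₂_apply] at h'
    exact h'.lineDifferentiableAt
  have hpoly : ∀ p, HasIterPartials coordDir U z.1 k (zeroExt (polyFun Ω p)) :=
    hasPartialsOn_polyFun hU hUΩ
  -- The finite sum in the Gram kernel is grouped by its factor in `x`: the left summands carry `P t
  -- x`, the right ones `K t x`.
  refine ⟨hKt, hasIterPartials_of_gram (F := zeroExt₂ K) (J := T ⊕ T)
    (a := Sum.elim (fun t => zeroExt (polyFun Ω (P t))) (fun t => zeroExt (K t)))
    (b := Sum.elim
      (fun t y => -1 * zeroExt (K t) y + ∑ u : T, K t u * zeroExt (polyFun Ω (P u)) y)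
      (fun t y => -1 * zeroExt (polyFun Ω (P t)) y)) hU ?_ ?_ ?_ hF hFc⟩
  · intro x hx y hy
    lift x to Ω using hUΩ hx
    lift y to Ω using hUΩ hy
    simp only [Subtype.val_injective.extend_apply, inner_interpError_interpError,
      Fintype.sum_sum_type, Sum.elim_inl, Sum.elim_inr, zeroExt₂_apply, zeroExt_apply]
    have h1 : ∀ t : T, K x t = K t x := fun t => K.symm x t
    simp only [h1, mul_add, mul_sub, Finset.sum_add_distrib, Finset.sum_sub_distrib, neg_one_mul,
      mul_neg, Finset.sum_neg_distrib]
    have h2 : ∑ t : T, polyFun Ω (P t) y * K t x = ∑ t : T, K t x * polyFun Ω (P t) y :=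
      Finset.sum_congr rfl fun _ _ => mul_comm _ _
    have h3 : ∀ t : T, ∑ u : T, polyFun Ω (P u) y * K t u = ∑ u : T, K t u * polyFun Ω (P u) y :=
      fun t => Finset.sum_congr rfl fun _ _ => mul_comm _ _
    rw [h2]
    simp only [h3]
    ring
  · rintro (t | t)
    · exact hpoly _
    · exact hKt t t.2
  · rintro (t | t)
    · exact (HasIterPartials.add hU (HasIterPartials.const_mul hU (hKt t t.2) _)
        (HasIterPartials.sum hU _ fun u _ => HasIterPartials.const_mul hU (hpoly _) _)).1
    · exact HasIterPartials.const_mul hU (hpoly _) _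

end

theorem proposition2 {d s k N : ℕ} {Ω : Set (Eucl d)} (K : CPDKernel Ω s)
    (a : (Fin d → ℕ) → Eucl d → ℝ) (z : Ω) (hK : KernelPartialsExistAt k K z)
    (x : Fin N → Ω) (w : Fin N → ℝ)
    (hw : ∀ p ∈ polySpace d s, errorFunctional k a z x w (polyFun Ω p) = 0) :
    -- everything that is differentiated below is differentiable
    (∀ f : NativeSpace K, HasPartialsAt k f z) ∧
    (∀ y : Ω, HasPartialsAt k (K y) z) ∧
    HasPartialsAt k (fun y => errorFunctional k a z x w (K y)) z ∧
    -- the error functional is continuous on the native space, with the asserted norm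
    ∃ ε : NativeSpace K →L[ℝ] ℝ,
      (∀ f : NativeSpace K, ε f = errorFunctional k a z x w f) ∧
      ‖ε‖ ^ 2 = errorFunctional k a z x w (fun y => errorFunctional k a z x w (K y)) := by
  obtain ⟨U, hUΩ, hz, hU, hdet, hF, hFc⟩ := hK.exists_domain
  obtain ⟨T, P, hT, hPs, hP⟩ := exists_polynomial_interpolation (s := s) hdet
  obtain ⟨hKt, hE⟩ := hasIterPartials_interpError (K := K) hU hUΩ hT hP hF hFc
  set E : Eucl d → NativeCompletion K :=
    Function.extend Subtype.val (fun x : Ω => (interpError K hP x : NativeCompletion K)) 0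
  -- The Riesz representer of the error functional.
  set v : NativeCompletion K :=
    vecDiffOp k a E z - ∑ j, w j • (interpError K hP (x j) : NativeCompletion K)
  have hinner := fun h p hp => hasPartialsOn_inner_add_polyFun (a := a) (x := x) (w := w) (p := p)
    (E₀ := fun y => (interpError K hP y : NativeCompletion K))
    (fun y => Subtype.val_injective.extend_apply _ _ y) hU hUΩ hz hE hw h hp
  have hsum : ∀ c : T → ℝ, ∑ t, c t • P t ∈ polySpace d s := fun c =>
    Submodule.sum_mem _ fun t _ => Submodule.smul_mem _ _ (hPs t)
  have hnat : ∀ f : NativeSpace K, HasPartialsOn U k z f ∧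
      errorFunctional k a z x w f = inner ℝ v (nativeClass K f) := by
    intro f
    have h := hinner (nativeClass K f) _ (hsum fun t => (f : Ω → ℝ) t)
    have hf : IsNativeLimit K f (nativeClass K f) := f.2.choose_spec
    rwa [← hf.eq_inner_add hP] at h
  have hker : ∀ y : Ω, HasPartialsOn U k z (K y) ∧ errorFunctional k a z x w (K y) =
      inner ℝ (interpError K hP y : NativeCompletion K) v +
        polyFun Ω (∑ t : T, errorFunctional k a z x w (K t) • P t) y := by
    intro y
    have h1 := hinner (interpError K hP y) _
      (hsum fun t => K t y - ∑ u : T, polyFun Ω (P u) y * K t u)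
    have h2 := HasPartialsOn.sum_const_mul (a := a) (x := x) (w := w) hU hz (Finset.univ : Finset T)
      (F := fun t => K t) (fun t _ => hKt t t.2) (fun t => polyFun Ω (P t) y)
    have h3 := h1.1.add (a := a) (x := x) (w := w) hU hz h2.1
    rw [h1.2, h2.2, ← kernel_eq_inner_add hP y] at h3
    refine ⟨h3.1, ?_⟩
    rw [h3.2, polyFun_sum_smul, real_inner_comm]
  -- The once-applied kernel is again an inner product with `E` plus an element of `Π^d_s`, so the
  -- second application yields `⟪v, v⟫`.
  have hrep := hinner v _ (hsum fun t => errorFunctional k a z x w (K t))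
  rw [← funext fun y => (hker y).2] at hrep
  refine ⟨fun f => (hnat f).1.hasPartialsAt hU hz, fun y => (hker y).1.hasPartialsAt hU hz,
    hrep.1.hasPartialsAt hU hz, ?_⟩
  have hbound : ∀ f : NativeSpace K, ‖inner ℝ v (nativeClass K f)‖ ≤ ‖v‖ * ‖f‖ := by
    intro f
    rw [← norm_nativeClass f]
    exact norm_inner_le_norm v _
  refine ⟨((innerSL ℝ v).toLinearMap.comp (nativeClass K)).mkContinuous ‖v‖ hbound,
    fun f => (hnat f).2.symm, ?_⟩
  rw [hrep.2, real_inner_self_eq_norm_sq]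
  congr 1
  refine le_antisymm (LinearMap.mkContinuous_norm_le _ (norm_nonneg v) _) ?_
  -- A native function with class `v` is extremal in the Cauchy–Schwarz inequality.
  let f : NativeSpace K := ⟨_, v, isNativeLimit_inner_interpError hP hPs v⟩
  have hf : nativeClass K f = v :=
    f.2.choose_spec.unique (isNativeLimit_inner_interpError hP hPs v)
  have h := (((innerSL ℝ v).toLinearMap.comp (nativeClass K)).mkContinuous ‖v‖ hbound).le_opNorm f
  have h' : ‖inner ℝ v (nativeClass K f)‖ ≤
    ‖((innerSL ℝ v).toLinearMap.comp (nativeClass K)).mkContinuous ‖v‖ hbound‖ * ‖f‖ := h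
  rw [← norm_nativeClass f, hf, real_inner_self_eq_norm_sq, Real.norm_of_nonneg (by positivity),
    sq] at h'
  rcases (norm_nonneg v).eq_or_lt with h0 | h0
  · exact h0.symm.le.trans (ContinuousLinearMap.opNorm_nonneg _)
  · exact le_of_mul_le_mul_right h' h0
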